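/- Let $k$ be a field, $H$ a Hopf algebra over $k$ with coproduct $\Delta(h)=h_1\otimes h_2$ and antipode $S$, and let $A$ be a right $H$-comodule algebra over $k$ with coaction $\Delta_A\colon A\to A\otimes H$, $a\mapsto a_0\otimes a_1$. Assume that $B:=A^{\mathrm{co}H}=\{a:\Delta_A(a)=a\otimes 1\}\subseteq A$ is a quantum principal bundle, i.e. a faithfully flat Hopf--Galois extension: the map $A\otimes_BA\to A\otimes H$, $a\otimes_B a'\mapsto aa'_0\otimes a'_1$, is bijective, and $A$ is faithfully flat as a left $B$-module. Let $(\Gamma,\mathrm d)$ be a bicovariant first order differential calculus on $H$: an $H$-bimodule $\Gamma$ with a $k$-linear $\mathrm d\colon H\to\Gamma$ satisfying the Leibniz rule, $\Gamma=\mathrm{span}_k\{h\,\mathrm dh'\}$, carrying a left coaction $\lambda\colon\Gamma\to H\otimes\Gamma$, $\gamma\mapsto\gamma_{-1}\otimes\gamma_0$, and a right coaction $\Gamma\to\Gamma\otimes H$, which are compatible with both module structures (via $\Delta$) and with $\mathrm d$. Let $\Omega^\bullet(H)$ be its maximal prolongation, i.e. the quotient of the tensor algebra of the bimodule $\Gamma$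 over $H$ by the ideal generated by all $\sum_i\mathrm da_i\otimes\mathrm db_i$ with $\sum_ia_i\,\mathrm db_i=0$, with the induced differential. Put $\Lambda^1=\{\theta\in\Gamma:\lambda(\theta)=1\otimes\theta\}$, $\pi_{inv}\colon\Gamma\to\Lambda^1$, $\pi_{inv}(\gamma)=S(\gamma_{-1})\gamma_0$, and $\theta\leftharpoonup h=S(h_1)\theta h_2$ for $\theta\in\Lambda^1$, $h\in H$. Let $\Omega^\bullet(A)$ be a differential calculus on $A$, i.e. a differential graded $k$-algebra with $\Omega^0(A)=A$ in which $\Omega^n(A)$ is spanned by the forms $a^0\mathrm da^1\wedge\dots\wedge\mathrm da^n$. Assume that it is complete: $\Delta_A$ extends to a morphism of differential graded algebras $\Delta_A^\wedge\colon\Omega^\bullet(A)\to\Omega^\bullet(A)\otimes\Omega^\bullet(H)$, where the right hand side is the graded tensor product. (Such an extension is unique.) Define * the horizontal one-forms $\mathfrak{hor}^1(A)=\{\omega\in\Omega^1(A):\Delta_A^\wedge(\omega)\in\Omega^\bullet(A)\otimes H\}$; * the vertical one-forms $\mathfrak{ver}^1(A)=A\otimes\Lambda^1$, with $a(b\otimes\theta)=ab\otimes\theta$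 and $(b\otimes\theta)a=ba_0\otimes(\theta\leftharpoonup a_1)$; * $\pi_{\mathfrak{ver}}=(\mathrm{id}\otimes(\pi_{inv}\circ\pi_1))\circ\Delta_A^\wedge\colon\Omega^1(A)\to\mathfrak{ver}^1(A)$, where $\pi_1\colon\Omega^\bullet(H)\to\Omega^1(H)=\Gamma$ is the projection. **Lemma.** $\mathfrak{hor}^1(A)$ is stable under left and right multiplication by $A$ in $\Omega^1(A)$, the map $\pi_{\mathfrak{ver}}\colon\Omega^1(A)\to\mathfrak{ver}^1(A)$ is left and right $A$-linear, and $$0\longrightarrow\mathfrak{hor}^1(A)\hookrightarrow\Omega^1(A)\xrightarrow{\ \pi_{\mathfrak{ver}}\ }\mathfrak{ver}^1(A)\longrightarrow0$$ is a short exact sequence of $A$-bimodules: the inclusion is injective, $\ker\pi_{\mathfrak{ver}}=\mathfrak{hor}^1(A)$ in degree one, and $\pi_{\mathfrak{ver}}$ is surjective. -/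

import Mathlib

open scoped TensorProduct DirectSum
open MulOpposite

set_option linter.unusedSectionVars false

namespace QuantumBundle

/-! ### First order differential calculi and their maximal prolongation -/

section FirstOrder

variable (k : Type*) [Field k] (A : Type*) [Ring A] [Algebra k A]
  (Γ : Type*) [AddCommGroup Γ] [Module k Γ] [Module A Γ] [Module Aᵐᵒᵖ Γ]

/-- A first order differential calculus on the `k`-algebra `A` with bimodule of one-forms `Γ`. -/
structure FirstOrderCalculus where
  /-- The differential. -/
  d : A →ₗ[k] Γ
  leibniz : ∀ a b : A, d (a * b) = op b • d a + a • d b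
  span_eq_top : Submodule.span k {γ : Γ | ∃ a b : A, γ = a • d b} = ⊤

end FirstOrder

section MaximalProlongation

variable {k : Type*} [Field k] {A : Type*} [Ring A] [Algebra k A]
  {Γ : Type*} [AddCommGroup Γ] [Module k Γ] [Module A Γ] [Module Aᵐᵒᵖ Γ]

namespace FirstOrderCalculus

/-- The relations of the maximal prolongation, imposed on the free `k`-algebra on `A × Γ`.
The first four families present the tensor algebra of the bimodule `Γ` over `A`; the last one
generates the ideal of all `∑ d aᵢ ⊗ d bᵢ` with `∑ aᵢ d bᵢ = 0`. -/
inductive Rel (C : FirstOrderCalculus k A Γ) :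
    TensorAlgebra k (A × Γ) → TensorAlgebra k (A × Γ) → Prop
  | one : Rel C (TensorAlgebra.ι k (1, 0)) 1
  | mul (a b : A) : Rel C (TensorAlgebra.ι k (a, 0) * TensorAlgebra.ι k (b, 0))
      (TensorAlgebra.ι k (a * b, 0))
  | left (a : A) (γ : Γ) : Rel C (TensorAlgebra.ι k (a, 0) * TensorAlgebra.ι k (0, γ))
      (TensorAlgebra.ι k (0, a • γ))
  | right (γ : Γ) (a : A) : Rel C (TensorAlgebra.ι k (0, γ) * TensorAlgebra.ι k (a, 0))
      (TensorAlgebra.ι k (0, op a • γ))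
  | wedge (n : ℕ) (a b : Fin n → A) (h : ∑ i, a i • C.d (b i) = 0) :
      Rel C (∑ i, TensorAlgebra.ι k (0, C.d (a i)) * TensorAlgebra.ι k (0, C.d (b i))) 0

/-- The maximal prolongation `Γ^∧` of a first order calculus `(Γ, d)`: the quotient of the tensor
algebra of the bimodule `Γ` by the ideal generated by all `∑ d aᵢ ⊗ d bᵢ` with `∑ aᵢ d bᵢ = 0`. -/
def MaxProl (C : FirstOrderCalculus k A Γ) : Type _ := RingQuot C.Rel

namespace MaxProl

variable (C : FirstOrderCalculus k A Γ)

noncomputable instance : Ring C.MaxProl := inferInstanceAs (Ring (RingQuot C.Rel))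
noncomputable instance : Algebra k C.MaxProl := inferInstanceAs (Algebra k (RingQuot C.Rel))

/-- The quotient map. -/
noncomputable def mk : TensorAlgebra k (A × Γ) →ₐ[k] C.MaxProl := RingQuot.mkAlgHom k C.Rel

theorem mk_rel {x y : TensorAlgebra k (A × Γ)} (h : C.Rel x y) : mk C x = mk C y :=
  RingQuot.mkAlgHom_rel k h

/-- The inclusion of the forms of degree zero. -/
noncomputable def inl : A →ₐ[k] C.MaxProl :=
  AlgHom.ofLinearMap ((mk C).toLinearMap ∘ₗ TensorAlgebra.ι k ∘ₗ LinearMap.inl k A Γ)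
    (by simpa using mk_rel C Rel.one)
    (fun a b => by simpa using (mk_rel C (Rel.mul a b)).symm)

/-- The inclusion of the forms of degree one. -/
noncomputable def inr : Γ →ₗ[k] C.MaxProl :=
  (mk C).toLinearMap ∘ₗ TensorAlgebra.ι k ∘ₗ LinearMap.inr k A Γ

theorem inl_mul_inr (a : A) (γ : Γ) : inl C a * inr C γ = inr C (a • γ) := by
  simpa [inl, inr] using mk_rel C (Rel.left a γ)

theorem inr_mul_inl (γ : Γ) (a : A) : inr C γ * inl C a = inr C (op a • γ) := by
  simpa [inl, inr] using mk_rel C (Rel.right γ a)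

theorem sum_inr_mul_inr (n : ℕ) (a b : Fin n → A) (h : ∑ i, a i • C.d (b i) = 0) :
    ∑ i, inr C (C.d (a i)) * inr C (C.d (b i)) = 0 := by
  simpa [inr] using mk_rel C (Rel.wedge n a b h)

variable {C}

/-- Algebra homomorphisms out of the maximal prolongation. -/
noncomputable def lift {R : Type*} [Ring R] [Algebra k R] (f : A →ₐ[k] R) (g : Γ →ₗ[k] R)
    (hl : ∀ a γ, f a * g γ = g (a • γ)) (hr : ∀ γ a, g γ * f a = g (op a • γ))
    (hw : ∀ (n : ℕ) (a b : Fin n → A), ∑ i, a i • C.d (b i) = 0 →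
      ∑ i, g (C.d (a i)) * g (C.d (b i)) = 0) : C.MaxProl →ₐ[k] R :=
  RingQuot.liftAlgHom k ⟨TensorAlgebra.lift k (f.toLinearMap.coprod g), by
    intro x y h
    induction h with
    | one => simp
    | mul a b => simp
    | left a γ => simpa using hl a γ
    | right γ a => simpa using hr γ a
    | wedge n a b h => simpa using hw n a b h⟩

section
variable {R : Type*} [Ring R] [Algebra k R] (f : A →ₐ[k] R) (g : Γ →ₗ[k] R)
    (hl : ∀ a γ, f a * g γ = g (a • γ)) (hr : ∀ γ a, g γ * f a = g (op a • γ))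
    (hw : ∀ (n : ℕ) (a b : Fin n → A), ∑ i, a i • C.d (b i) = 0 →
      ∑ i, g (C.d (a i)) * g (C.d (b i)) = 0)

@[simp] theorem lift_inl (a : A) : lift f g hl hr hw (inl C a) = f a := by
  have : lift f g hl hr hw (inl C a) = TensorAlgebra.lift k (f.toLinearMap.coprod g)
      (TensorAlgebra.ι k (a, 0)) := RingQuot.liftAlgHom_mkAlgHom_apply k _ _ _
  rw [this]; simp

@[simp] theorem lift_inr (γ : Γ) : lift f g hl hr hw (inr C γ) = g γ := by
  have : lift f g hl hr hw (inr C γ) = TensorAlgebra.lift k (f.toLinearMap.coprod g)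
      (TensorAlgebra.ι k (0, γ)) := RingQuot.liftAlgHom_mkAlgHom_apply k _ _ _
  rw [this]; simp
end

theorem hom_ext {R : Type*} [Ring R] [Algebra k R] {F G : C.MaxProl →ₐ[k] R}
    (h0 : ∀ a, F (inl C a) = G (inl C a)) (h1 : ∀ γ, F (inr C γ) = G (inr C γ)) : F = G := by
  apply RingQuot.ringQuot_ext'
  apply TensorAlgebra.hom_ext
  ext x
  · exact h0 x
  · exact h1 x

/-! #### The grading -/

variable (C)

/-- The forms of degree `n` in the maximal prolongation: the span of the products
`a γ₁ ⋯ γₙ`. -/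
noncomputable def deg (n : ℕ) : Submodule k C.MaxProl :=
  LinearMap.range (inl C).toLinearMap * LinearMap.range (inr C) ^ n

theorem inl_mem (a : A) : inl C a ∈ LinearMap.range (inl C).toLinearMap := ⟨a, rfl⟩

theorem one_le_range_inl : 1 ≤ LinearMap.range (inl C).toLinearMap :=
  Submodule.one_le.mpr ⟨1, map_one (inl C)⟩

theorem range_inl_mul_self :
    LinearMap.range (inl C).toLinearMap * LinearMap.range (inl C).toLinearMap =
      LinearMap.range (inl C).toLinearMap := by
  apply le_antisymm
  · rw [Submodule.mul_le]
    rintro _ ⟨a, rfl⟩ _ ⟨b, rfl⟩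
    exact ⟨a * b, map_mul (inl C) a b⟩
  · calc _ = 1 * LinearMap.range (inl C).toLinearMap := (one_mul _).symm
      _ ≤ _ := mul_le_mul_left (one_le_range_inl C) _

theorem deg_zero : deg C 0 = LinearMap.range (inl C).toLinearMap := by
  simp [deg]

theorem deg_one : deg C 1 = LinearMap.range (inr C) := by
  rw [deg, pow_one]
  apply le_antisymm
  · rw [Submodule.mul_le]
    rintro _ ⟨a, rfl⟩ _ ⟨γ, rfl⟩
    exact ⟨a • γ, (inl_mul_inr C a γ).symm⟩
  · rintro _ ⟨γ, rfl⟩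
    rw [← one_mul (inr C γ), ← map_one (inl C)]
    exact Submodule.mul_mem_mul (inl_mem C 1) ⟨γ, rfl⟩

theorem pow_mul_range_inl_le (n : ℕ) :
    LinearMap.range (inr C) ^ n * LinearMap.range (inl C).toLinearMap ≤ deg C n := by
  induction n with
  | zero => simp [deg]
  | succ n ih =>
    have h1 : LinearMap.range (inr C) * LinearMap.range (inl C).toLinearMap ≤
        LinearMap.range (inl C).toLinearMap * LinearMap.range (inr C) := by
      rw [← pow_one (LinearMap.range (inr C)), ← deg, deg_one, pow_one, Submodule.mul_le]
      rintro _ ⟨γ, rfl⟩ _ ⟨a, rfl⟩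
      exact ⟨op a • γ, (inr_mul_inl C γ a).symm⟩
    calc _ = LinearMap.range (inr C) ^ n *
          (LinearMap.range (inr C) * LinearMap.range (inl C).toLinearMap) := by
            rw [pow_succ, mul_assoc]
      _ ≤ LinearMap.range (inr C) ^ n *
          (LinearMap.range (inl C).toLinearMap * LinearMap.range (inr C)) :=
            mul_le_mul_right h1 _
      _ = LinearMap.range (inr C) ^ n * LinearMap.range (inl C).toLinearMap *
            LinearMap.range (inr C) := (mul_assoc _ _ _).symm
      _ ≤ deg C n * LinearMap.range (inr C) := mul_le_mul_left ih _
      _ = deg C (n + 1) := by rw [deg, deg, pow_succ, mul_assoc]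

instance gradedMonoid : SetLike.GradedMonoid (deg C) where
  one_mem := by rw [deg_zero]; exact ⟨1, map_one (inl C)⟩
  mul_mem m n x y hx hy := by
    have h : deg C m * deg C n ≤ deg C (m + n) := by
      calc deg C m * deg C n
          = LinearMap.range (inl C).toLinearMap * (LinearMap.range (inr C) ^ m *
            LinearMap.range (inl C).toLinearMap) * LinearMap.range (inr C) ^ n := by
              simp only [deg, mul_assoc]
        _ ≤ LinearMap.range (inl C).toLinearMap * deg C m * LinearMap.range (inr C) ^ n :=
            mul_le_mul_left (mul_le_mul_right (pow_mul_range_inl_le C m) _) _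
        _ = deg C (m + n) := by
            rw [deg, ← mul_assoc, range_inl_mul_self, mul_assoc, ← pow_add, deg]
    exact h (Submodule.mul_mem_mul hx hy)

theorem inl_mem_deg (a : A) : inl C a ∈ deg C 0 := by rw [deg_zero]; exact inl_mem C a

theorem inr_mem_deg (γ : Γ) : inr C γ ∈ deg C 1 := by rw [deg_one]; exact ⟨γ, rfl⟩

theorem toLinearMap_inl_mem_deg (a : A) : (inl C).toLinearMap a ∈ deg C 0 := inl_mem_deg C a

/-- The inclusion of the degree zero forms into the graded object. -/
noncomputable def gradedInl : A →ₗ[k] ⨁ n, deg C n :=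
  DirectSum.lof k ℕ (fun n => deg C n) 0 ∘ₗ
    (inl C).toLinearMap.codRestrict (deg C 0) (toLinearMap_inl_mem_deg C)

/-- The inclusion of the degree one forms into the graded object. -/
noncomputable def gradedInr : Γ →ₗ[k] ⨁ n, deg C n :=
  DirectSum.lof k ℕ (fun n => deg C n) 1 ∘ₗ (inr C).codRestrict (deg C 1) (inr_mem_deg C)

theorem gradedInl_apply (a : A) : gradedInl C a =
    DirectSum.of (fun n => deg C n) 0 ⟨inl C a, inl_mem_deg C a⟩ := rfl

theorem gradedInr_apply (γ : Γ) : gradedInr C γ =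
    DirectSum.of (fun n => deg C n) 1 ⟨inr C γ, inr_mem_deg C γ⟩ := rfl

theorem gradedInl_one : gradedInl C 1 = 1 := by
  rw [gradedInl_apply]
  exact DirectSum.of_eq_of_gradedMonoid_eq (Sigma.subtype_ext rfl (map_one (inl C)))

theorem gradedInl_mul (a b : A) : gradedInl C (a * b) = gradedInl C a * gradedInl C b := by
  rw [gradedInl_apply, gradedInl_apply, gradedInl_apply, DirectSum.of_mul_of]
  exact DirectSum.of_eq_of_gradedMonoid_eq (Sigma.subtype_ext rfl (map_mul (inl C) a b))

/-- `gradedInl` as an algebra homomorphism. -/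
noncomputable def gradedInlHom : A →ₐ[k] ⨁ n, deg C n :=
  AlgHom.ofLinearMap (gradedInl C) (gradedInl_one C) (gradedInl_mul C)

theorem gradedInlHom_apply (a : A) : gradedInlHom C a =
    DirectSum.of (fun n => deg C n) 0 ⟨inl C a, inl_mem_deg C a⟩ := rfl

/-- The grading as an algebra homomorphism. -/
noncomputable def toDirectSum : C.MaxProl →ₐ[k] ⨁ n, deg C n :=
  lift (R := ⨁ n, deg C n) (gradedInlHom C) (gradedInr C)
    (fun a γ => by
      rw [gradedInlHom_apply, gradedInr_apply, gradedInr_apply,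
        DirectSum.of_mul_of]
      exact DirectSum.of_eq_of_gradedMonoid_eq (Sigma.subtype_ext rfl (inl_mul_inr C a γ)))
    (fun γ a => by
      rw [gradedInlHom_apply, gradedInr_apply, gradedInr_apply,
        DirectSum.of_mul_of]
      exact DirectSum.of_eq_of_gradedMonoid_eq (Sigma.subtype_ext rfl (inr_mul_inl C γ a)))
    (fun n a b h => by
      simp only [gradedInr_apply, DirectSum.of_mul_of]
      rw [← map_sum]
      refine (congrArg _ ?_).trans (map_zero (DirectSum.of (fun n => deg C n) (1 + 1)))
      apply Subtype.ext
      rw [AddSubmonoidClass.coe_finsetSum]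
      exact sum_inr_mul_inr C n a b h)

theorem toDirectSum_inl (a : A) : toDirectSum C (inl C a) =
    DirectSum.of (fun n => deg C n) 0 ⟨inl C a, inl_mem_deg C a⟩ := by
  rw [toDirectSum, lift_inl, gradedInlHom_apply]

theorem toDirectSum_inr (γ : Γ) : toDirectSum C (inr C γ) =
    DirectSum.of (fun n => deg C n) 1 ⟨inr C γ, inr_mem_deg C γ⟩ := by
  rw [toDirectSum, lift_inr, gradedInr_apply]

theorem toDirectSum_spec (n : ℕ) {x : C.MaxProl} (hx : x ∈ deg C n) :
    ∃ h : x ∈ deg C n, toDirectSum C x = DirectSum.of (fun n => deg C n) n ⟨x, h⟩ := by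
  have hmul : ∀ (m n : ℕ) (x y : C.MaxProl),
      (∃ h : x ∈ deg C m, toDirectSum C x = DirectSum.of (fun n => deg C n) m ⟨x, h⟩) →
      (∃ h : y ∈ deg C n, toDirectSum C y = DirectSum.of (fun n => deg C n) n ⟨y, h⟩) →
      ∃ h : x * y ∈ deg C (m + n),
        toDirectSum C (x * y) = DirectSum.of (fun n => deg C n) (m + n) ⟨x * y, h⟩ := by
    rintro m n x y ⟨h1, e1⟩ ⟨h2, e2⟩
    refine ⟨SetLike.mul_mem_graded h1 h2, ?_⟩
    rw [map_mul, e1, e2, DirectSum.of_mul_of]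
    rfl
  have hadd : ∀ (n : ℕ) (x y : C.MaxProl),
      (∃ h : x ∈ deg C n, toDirectSum C x = DirectSum.of (fun n => deg C n) n ⟨x, h⟩) →
      (∃ h : y ∈ deg C n, toDirectSum C y = DirectSum.of (fun n => deg C n) n ⟨y, h⟩) →
      ∃ h : x + y ∈ deg C n,
        toDirectSum C (x + y) = DirectSum.of (fun n => deg C n) n ⟨x + y, h⟩ := by
    rintro n x y ⟨h1, e1⟩ ⟨h2, e2⟩
    refine ⟨add_mem h1 h2, ?_⟩
    rw [map_add, e1, e2, ← map_add]
    rfl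
  have h0 : ∀ a, ∃ h : inl C a ∈ deg C 0,
      toDirectSum C (inl C a) = DirectSum.of (fun n => deg C n) 0 ⟨inl C a, h⟩ :=
    fun a => ⟨inl_mem_deg C a, toDirectSum_inl C a⟩
  have h1 : ∀ γ, ∃ h : inr C γ ∈ deg C 1,
      toDirectSum C (inr C γ) = DirectSum.of (fun n => deg C n) 1 ⟨inr C γ, h⟩ :=
    fun γ => ⟨inr_mem_deg C γ, toDirectSum_inr C γ⟩
  have hpow : ∀ (n : ℕ), ∀ y ∈ LinearMap.range (inr C) ^ n, ∃ h : y ∈ deg C n,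
      toDirectSum C y = DirectSum.of (fun n => deg C n) n ⟨y, h⟩ := by
    intro n
    induction n with
    | zero =>
      intro y hy
      rw [pow_zero, Submodule.mem_one] at hy
      obtain ⟨r, rfl⟩ := hy
      rw [← (inl C).commutes r]
      exact h0 _
    | succ n ih =>
      intro y hy
      rw [pow_succ] at hy
      refine Submodule.mul_induction_on hy ?_ (hadd _)
      rintro x hx _ ⟨γ, rfl⟩
      exact hmul _ _ _ _ (ih x hx) (h1 γ)
  refine Submodule.mul_induction_on hx ?_ (hadd _)
  rintro _ ⟨a, rfl⟩ y hy
  have := hmul 0 n _ _ (h0 a) (hpow n y hy)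
  rwa [zero_add] at this

noncomputable instance gradedAlgebra : GradedAlgebra (deg C) :=
  GradedAlgebra.ofAlgHom (deg C) (toDirectSum C)
    (hom_ext
      (fun a => by
        rw [AlgHom.comp_apply, toDirectSum_inl]
        exact DirectSum.coeAlgHom_of _ _ _)
      (fun γ => by
        rw [AlgHom.comp_apply, toDirectSum_inr]
        exact DirectSum.coeAlgHom_of _ _ _))
    (fun n x => (toDirectSum_spec C n x.2).2)

/-! #### The differential -/

variable [IsScalarTower k A Γ] [IsScalarTower k Aᵐᵒᵖ Γ] [SMulCommClass A Aᵐᵒᵖ Γ]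

/-- `a ⊗ b ↦ a d b`, as a map to one-forms. -/
noncomputable def formMap : A ⊗[k] A →ₗ[k] Γ :=
  TensorProduct.lift ((Algebra.lsmul k k Γ).toLinearMap.compl₂ C.d)

theorem formMap_tmul (a b : A) :
    formMap C (a ⊗ₜ b) = a • C.d b := rfl

theorem formMap_surjective :
    Function.Surjective (formMap C) := by
  rw [← LinearMap.range_eq_top, eq_top_iff, ← C.span_eq_top, Submodule.span_le]
  rintro _ ⟨a, b, rfl⟩
  exact ⟨a ⊗ₜ b, formMap_tmul C a b⟩

/-- `a ⊗ b ↦ d a ∧ d b`. -/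
noncomputable def wedgeMap : A ⊗[k] A →ₗ[k] C.MaxProl :=
  LinearMap.mul' k C.MaxProl ∘ₗ TensorProduct.map (inr C ∘ₗ C.d) (inr C ∘ₗ C.d)

theorem wedgeMap_tmul (a b : A) :
    wedgeMap C (a ⊗ₜ b) = inr C (C.d a) * inr C (C.d b) := rfl

theorem ker_formMap_le : LinearMap.ker (formMap C) ≤ LinearMap.ker (wedgeMap C) := by
  intro t ht
  obtain ⟨n, a, b, rfl⟩ : ∃ (n : ℕ) (a b : Fin n → A), t = ∑ i, a i ⊗ₜ[k] b i := by
    obtain ⟨n, a, b, h⟩ := TensorProduct.exists_sum_tmul_eq t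
    exact ⟨n, a, b, h⟩
  rw [LinearMap.mem_ker, map_sum] at ht ⊢
  simp only [wedgeMap_tmul]
  simp only [formMap_tmul] at ht
  exact sum_inr_mul_inr C n a b ht

/-- The differential on one-forms, `a d b ↦ d a ∧ d b`. -/
noncomputable def dOne : Γ →ₗ[k] C.MaxProl :=
  (LinearMap.ker (formMap C)).liftQ (wedgeMap C) (ker_formMap_le C) ∘ₗ
    ((formMap C).quotKerEquivOfSurjective (formMap_surjective C)).symm.toLinearMap

theorem dOne_smul_d (a b : A) : dOne C (a • C.d b) = inr C (C.d a) * inr C (C.d b) := by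
  have h : ((formMap C).quotKerEquivOfSurjective (formMap_surjective C)).symm (a • C.d b) =
      Submodule.Quotient.mk (a ⊗ₜ b) := by
    rw [LinearEquiv.symm_apply_eq]
    rfl
  rw [dOne, LinearMap.comp_apply, LinearEquiv.coe_coe, h]
  rfl

theorem d_one : C.d 1 = 0 := by
  have h := C.leibniz 1 1
  simpa using h

theorem dOne_d (a : A) : dOne C (C.d a) = 0 := by
  have h := dOne_smul_d C 1 a
  rwa [one_smul, d_one, map_zero, zero_mul] at h

theorem induction_form {P : Γ → Prop} (γ : Γ) (hd : ∀ a b : A, P (a • C.d b)) (h0 : P 0)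
    (ha : ∀ x y, P x → P y → P (x + y)) : P γ := by
  obtain ⟨t, rfl⟩ := formMap_surjective C γ
  induction t with
  | zero => rwa [map_zero]
  | tmul a b => exact hd a b
  | add x y hx hy => rw [map_add]; exact ha _ _ hx hy

theorem dOne_smul (a : A) (γ : Γ) :
    dOne C (a • γ) = inr C (C.d a) * inr C γ + inl C a * dOne C γ := by
  refine induction_form C (P := fun γ => dOne C (a • γ) = inr C (C.d a) * inr C γ + inl C a * dOne C γ)
    γ (fun b c => ?_) (by simp) (fun x y hx hy => ?_)
  · rw [smul_smul, dOne_smul_d, dOne_smul_d, C.leibniz, map_add, add_mul, ← inr_mul_inl,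
      ← inl_mul_inr, ← inl_mul_inr, mul_assoc, mul_assoc]
  · rw [smul_add, map_add, hx, hy, map_add, map_add, mul_add, mul_add]; abel

theorem dOne_op_smul (γ : Γ) (a : A) :
    dOne C (op a • γ) = dOne C γ * inl C a - inr C γ * inr C (C.d a) := by
  refine induction_form C
    (P := fun γ => dOne C (op a • γ) = dOne C γ * inl C a - inr C γ * inr C (C.d a))
    γ (fun b c => ?_) (by simp) (fun x y hx hy => ?_)
  · have h : op a • b • C.d c = b • C.d (c * a) - (b * c) • C.d a := by
      rw [C.leibniz, smul_add, smul_smul, add_sub_cancel_right,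
        ← smul_comm b (op a)]
    rw [h, map_sub, dOne_smul_d, dOne_smul_d, dOne_smul_d, C.leibniz, C.leibniz, map_add, map_add,
      mul_add, add_mul, mul_assoc, inr_mul_inl, ← inl_mul_inr, ← inl_mul_inr, ← inr_mul_inl,
      ← inr_mul_inl]
    simp only [mul_assoc]
    abel
  · rw [smul_add, map_add, hx, hy, map_add, map_add, add_mul, add_mul]; abel

/-- The degree zero part of `dMatrix`. -/
noncomputable def dMatrixInl : A →ₐ[k] Matrix (Fin 2) (Fin 2) C.MaxProl :=
  AlgHom.ofLinearMap
    { toFun := fun a => !![inl C a, inr C (C.d a); 0, inl C a]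
      map_add' := fun a b => by ext i j; fin_cases i <;> fin_cases j <;> simp
      map_smul' := fun r a => by ext i j; fin_cases i <;> fin_cases j <;> simp }
    (by ext i j; fin_cases i <;> fin_cases j <;> simp [d_one])
    (fun a b => by
      ext i j
      fin_cases i <;> fin_cases j <;>
        simp [Matrix.mul_apply, C.leibniz, inl_mul_inr, inr_mul_inl, add_comm])

/-- The degree one part of `dMatrix`. -/
noncomputable def dMatrixInr : Γ →ₗ[k] Matrix (Fin 2) (Fin 2) C.MaxProl where
  toFun γ := !![-inr C γ, dOne C γ; 0, inr C γ]
  map_add' a b := by ext i j; fin_cases i <;> fin_cases j <;> simp [add_comm]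
  map_smul' r a := by ext i j; fin_cases i <;> fin_cases j <;> simp

theorem dMatrixInl_apply (a : A) :
    dMatrixInl C a = !![inl C a, inr C (C.d a); 0, inl C a] := rfl

theorem dMatrixInr_apply (γ : Γ) :
    dMatrixInr C γ = !![-inr C γ, dOne C γ; 0, inr C γ] := rfl

/-- The algebra homomorphism `ω ↦ !![(-1)^|ω| ω, d ω; 0, ω]`; its multiplicativity is the graded
Leibniz rule for `d`. -/
noncomputable def dMatrix : C.MaxProl →ₐ[k] Matrix (Fin 2) (Fin 2) C.MaxProl :=
  lift (dMatrixInl C) (dMatrixInr C)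
    (fun a γ => by
      rw [dMatrixInl_apply, dMatrixInr_apply, dMatrixInr_apply]
      ext i j
      fin_cases i <;> fin_cases j <;>
        simp [Matrix.mul_apply, inl_mul_inr, dOne_smul, add_comm])
    (fun γ a => by
      rw [dMatrixInl_apply, dMatrixInr_apply, dMatrixInr_apply]
      ext i j
      fin_cases i <;> fin_cases j <;>
        simp [Matrix.mul_apply, inr_mul_inl, dOne_op_smul, sub_eq_add_neg, add_comm])
    (fun n a b h => by
      have h' := sum_inr_mul_inr C n a b h
      simp only [dMatrixInr_apply, dOne_d]
      ext i j
      rw [Matrix.sum_apply]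
      fin_cases i <;> fin_cases j <;> simp [Matrix.mul_apply, h'])

/-- The differential of the maximal prolongation. -/
noncomputable def dMap : C.MaxProl →ₗ[k] C.MaxProl :=
  Matrix.entryLinearMap k C.MaxProl 0 1 ∘ₗ (dMatrix C).toLinearMap

theorem dMap_inl (a : A) : dMap C (inl C a) = inr C (C.d a) := by
  simp [dMap, dMatrix, dMatrixInl_apply]

theorem dMap_inr (γ : Γ) : dMap C (inr C γ) = dOne C γ := by
  simp [dMap, dMatrix, dMatrixInr_apply]

/-- The sign `(-1)^|ω|`, as an algebra endomorphism. -/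
noncomputable def signHom : C.MaxProl →ₐ[k] C.MaxProl :=
  lift (inl C) (-inr C) (fun a γ => by simp [inl_mul_inr]) (fun γ a => by simp [inr_mul_inl])
    (fun n a b h => by simpa using sum_inr_mul_inr C n a b h)

theorem dMatrix_apply (x : C.MaxProl) :
    dMatrix C x = !![signHom C x, dMap C x; 0, x] := by
  have key : dMatrix C x 0 0 = signHom C x ∧ dMatrix C x 1 0 = 0 ∧ dMatrix C x 1 1 = x := by
    have hx : x ∈ ⨆ n, deg C n := by
      rw [(DirectSum.Decomposition.isInternal (deg C)).submodule_iSup_eq_top]; trivial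
    have hmul : ∀ x y : C.MaxProl,
        (dMatrix C x 0 0 = signHom C x ∧ dMatrix C x 1 0 = 0 ∧ dMatrix C x 1 1 = x) →
        (dMatrix C y 0 0 = signHom C y ∧ dMatrix C y 1 0 = 0 ∧ dMatrix C y 1 1 = y) →
        (dMatrix C (x * y) 0 0 = signHom C (x * y) ∧ dMatrix C (x * y) 1 0 = 0 ∧
          dMatrix C (x * y) 1 1 = x * y) := by
      rintro x y ⟨h1, h2, h3⟩ ⟨h4, h5, h6⟩
      simp [Matrix.mul_apply, h1, h2, h3, h4, h5, h6]
    have hadd : ∀ x y : C.MaxProl,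
        (dMatrix C x 0 0 = signHom C x ∧ dMatrix C x 1 0 = 0 ∧ dMatrix C x 1 1 = x) →
        (dMatrix C y 0 0 = signHom C y ∧ dMatrix C y 1 0 = 0 ∧ dMatrix C y 1 1 = y) →
        (dMatrix C (x + y) 0 0 = signHom C (x + y) ∧ dMatrix C (x + y) 1 0 = 0 ∧
          dMatrix C (x + y) 1 1 = x + y) := by
      rintro x y ⟨h1, h2, h3⟩ ⟨h4, h5, h6⟩
      simp [h1, h2, h3, h4, h5, h6]
    have hpow : ∀ (n : ℕ), ∀ y ∈ LinearMap.range (inr C) ^ n,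
        (dMatrix C y 0 0 = signHom C y ∧ dMatrix C y 1 0 = 0 ∧ dMatrix C y 1 1 = y) := by
      intro n
      induction n with
      | zero =>
        intro y hy
        rw [pow_zero, Submodule.mem_one] at hy
        obtain ⟨r, rfl⟩ := hy
        simp [AlgHom.commutes, Matrix.algebraMap_matrix_apply]
      | succ n ih =>
        intro y hy
        rw [pow_succ] at hy
        refine Submodule.mul_induction_on hy ?_ hadd
        rintro x hx _ ⟨γ, rfl⟩
        refine hmul _ _ (ih x hx) ?_
        simp [dMatrix, dMatrixInr_apply, signHom]
    refine Submodule.iSup_induction (deg C) (motive := fun y =>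
      dMatrix C y 0 0 = signHom C y ∧ dMatrix C y 1 0 = 0 ∧ dMatrix C y 1 1 = y)
      hx (fun n y hy => ?_) (by simp) hadd
    refine Submodule.mul_induction_on hy ?_ hadd
    rintro _ ⟨a, rfl⟩ z hz
    refine hmul _ _ ?_ (hpow n z hz)
    simp [dMatrix, dMatrixInl_apply, signHom]
  ext i j
  fin_cases i <;> fin_cases j
  · exact key.1
  · rfl
  · exact key.2.1
  · exact key.2.2

theorem dMap_mul (x y : C.MaxProl) : dMap C (x * y) = dMap C x * y + signHom C x * dMap C y := by
  have h : dMatrix C (x * y) 0 1 = (dMatrix C x * dMatrix C y) 0 1 := by rw [map_mul]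
  rw [dMatrix_apply, dMatrix_apply C x, dMatrix_apply C y] at h
  simpa [Matrix.mul_apply, add_comm] using h

theorem signHom_of_mem (n : ℕ) {x : C.MaxProl} (hx : x ∈ deg C n) :
    signHom C x = (-1 : k) ^ n • x := by
  have hpow : ∀ (n : ℕ), ∀ y ∈ LinearMap.range (inr C) ^ n, signHom C y = (-1 : k) ^ n • y := by
    intro n
    induction n with
    | zero =>
      intro y hy
      rw [pow_zero, Submodule.mem_one] at hy
      obtain ⟨r, rfl⟩ := hy
      simp
    | succ n ih =>
      intro y hy
      rw [pow_succ] at hy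
      refine Submodule.mul_induction_on hy ?_ (fun x y hx hy => by rw [map_add, hx, hy, smul_add])
      rintro x hx _ ⟨γ, rfl⟩
      rw [map_mul, ih x hx, signHom, lift_inr, pow_succ]
      simp
  refine Submodule.mul_induction_on hx ?_ (fun x y hx hy => by rw [map_add, hx, hy, smul_add])
  rintro _ ⟨a, rfl⟩ y hy
  rw [map_mul, hpow n y hy, AlgHom.toLinearMap_apply, signHom, lift_inl, mul_smul_comm]

/-- The forms of degree `n` are the combinations of the `a₀ d a₁ ⋯ d aₙ`. -/
theorem deg_eq (n : ℕ) : deg C n = LinearMap.range (inl C).toLinearMap *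
    LinearMap.range (dMap C ∘ₗ (inl C).toLinearMap) ^ n := by
  have hD : LinearMap.range (dMap C ∘ₗ (inl C).toLinearMap) ≤ LinearMap.range (inr C) := by
    rintro _ ⟨a, rfl⟩
    exact ⟨C.d a, (dMap_inl C a).symm⟩
  have h1 : LinearMap.range (inr C) ≤ LinearMap.range (inl C).toLinearMap *
      LinearMap.range (dMap C ∘ₗ (inl C).toLinearMap) := by
    rintro _ ⟨γ, rfl⟩
    refine induction_form C (P := fun γ => inr C γ ∈ LinearMap.range (inl C).toLinearMap *
      LinearMap.range (dMap C ∘ₗ (inl C).toLinearMap)) γ (fun a b => ?_) (by simp)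
      (fun x y hx hy => ?_)
    · rw [← inl_mul_inr, ← dMap_inl]
      exact Submodule.mul_mem_mul (inl_mem C a) ⟨b, rfl⟩
    · rw [map_add]; exact add_mem hx hy
  have h2 : LinearMap.range (inr C) * LinearMap.range (inl C).toLinearMap ≤
      LinearMap.range (inr C) := by
    rw [Submodule.mul_le]
    rintro _ ⟨γ, rfl⟩ _ ⟨a, rfl⟩
    exact ⟨op a • γ, (inr_mul_inl C γ a).symm⟩
  apply le_antisymm
  · induction n with
    | zero => simp [deg]
    | succ n ih =>
      calc deg C (n + 1) = deg C n * LinearMap.range (inr C) := by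
            rw [deg, deg, pow_succ, mul_assoc]
        _ ≤ (LinearMap.range (inl C).toLinearMap *
              LinearMap.range (dMap C ∘ₗ (inl C).toLinearMap) ^ n) * LinearMap.range (inr C) :=
            mul_le_mul_left ih _
        _ ≤ _ := by
            rw [mul_assoc]
            clear ih
            have h3 : ∀ m, LinearMap.range (dMap C ∘ₗ (inl C).toLinearMap) ^ m *
                LinearMap.range (inr C) ≤ LinearMap.range (inl C).toLinearMap *
                LinearMap.range (dMap C ∘ₗ (inl C).toLinearMap) ^ (m + 1) := by
              intro m
              induction m with
              | zero => simpa using h1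
              | succ m ih =>
                calc _ = LinearMap.range (dMap C ∘ₗ (inl C).toLinearMap) *
                      (LinearMap.range (dMap C ∘ₗ (inl C).toLinearMap) ^ m *
                      LinearMap.range (inr C)) := by rw [pow_succ', mul_assoc]
                  _ ≤ LinearMap.range (dMap C ∘ₗ (inl C).toLinearMap) *
                      (LinearMap.range (inl C).toLinearMap *
                      LinearMap.range (dMap C ∘ₗ (inl C).toLinearMap) ^ (m + 1)) :=
                      mul_le_mul_right ih _
                  _ = LinearMap.range (dMap C ∘ₗ (inl C).toLinearMap) *
                      LinearMap.range (inl C).toLinearMap *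
                      LinearMap.range (dMap C ∘ₗ (inl C).toLinearMap) ^ (m + 1) :=
                      (mul_assoc _ _ _).symm
                  _ ≤ LinearMap.range (inr C) *
                      LinearMap.range (dMap C ∘ₗ (inl C).toLinearMap) ^ (m + 1) :=
                      mul_le_mul_left ((mul_le_mul_left hD _).trans h2) _
                  _ ≤ LinearMap.range (inl C).toLinearMap *
                      LinearMap.range (dMap C ∘ₗ (inl C).toLinearMap) *
                      LinearMap.range (dMap C ∘ₗ (inl C).toLinearMap) ^ (m + 1) :=
                      mul_le_mul_left h1 _
                  _ = _ := by rw [mul_assoc, ← pow_succ']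
            calc _ ≤ LinearMap.range (inl C).toLinearMap *
                  (LinearMap.range (inl C).toLinearMap *
                  LinearMap.range (dMap C ∘ₗ (inl C).toLinearMap) ^ (n + 1)) :=
                  mul_le_mul_right (h3 n) _
              _ = _ := by rw [← mul_assoc, range_inl_mul_self]
  · exact mul_le_mul_right (pow_le_pow_left' hD n) _

theorem dMap_pow (n : ℕ) {y : C.MaxProl}
    (hy : y ∈ LinearMap.range (dMap C ∘ₗ (inl C).toLinearMap) ^ n) : dMap C y = 0 := by
  induction n generalizing y with
  | zero =>
    rw [pow_zero, Submodule.mem_one] at hy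
    obtain ⟨r, rfl⟩ := hy
    rw [← (inl C).commutes r, dMap_inl, Algebra.algebraMap_eq_smul_one, map_smul, d_one, smul_zero,
      map_zero]
  | succ n ih =>
    rw [pow_succ] at hy
    refine Submodule.mul_induction_on hy ?_ (fun x y hx hy => by rw [map_add, hx, hy, add_zero])
    rintro x hx _ ⟨a, rfl⟩
    rw [dMap_mul, ih hx, LinearMap.comp_apply, AlgHom.toLinearMap_apply, dMap_inl, dMap_inr,
      dOne_d, zero_mul, mul_zero, add_zero]

theorem signHom_inl (a : A) : signHom C (inl C a) = inl C a := by
  rw [signHom, lift_inl]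

theorem dMap_mem (n : ℕ) {x : C.MaxProl} (hx : x ∈ deg C n) : dMap C x ∈ deg C (n + 1) := by
  rw [deg_eq] at hx
  refine Submodule.mul_induction_on hx ?_ (fun x y hx hy => by rw [map_add]; exact add_mem hx hy)
  rintro _ ⟨a, rfl⟩ y hy
  have hy' : y ∈ deg C n := by
    rw [deg_eq]
    simpa using Submodule.mul_mem_mul (inl_mem C 1) hy
  rw [dMap_mul, dMap_pow C n hy, mul_zero, add_zero, AlgHom.toLinearMap_apply, dMap_inl,
    add_comm n 1]
  exact SetLike.mul_mem_graded (inr_mem_deg C _) hy'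

theorem dMap_dMap (x : C.MaxProl) : dMap C (dMap C x) = 0 := by
  have hx : x ∈ ⨆ n, deg C n := by
    rw [(DirectSum.Decomposition.isInternal (deg C)).submodule_iSup_eq_top]; trivial
  refine Submodule.iSup_induction (deg C) (motive := fun y => dMap C (dMap C y) = 0) hx
    (fun n y hy => ?_) (by simp)
    (fun x y hx hy => by rw [map_add, map_add, hx, hy, add_zero])
  rw [deg_eq] at hy
  refine Submodule.mul_induction_on hy ?_
    (fun x y hx hy => by rw [map_add, map_add, hx, hy, add_zero])
  rintro _ ⟨a, rfl⟩ y hy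
  rw [dMap_mul, dMap_pow C n hy, mul_zero, add_zero, AlgHom.toLinearMap_apply]
  refine dMap_pow C (n + 1) ?_
  rw [pow_succ']
  exact Submodule.mul_mem_mul ⟨a, rfl⟩ hy

/-! #### The projections onto degrees zero and one -/

/-- The truncation of the maximal prolongation to degrees zero and one. -/
noncomputable def trunc : C.MaxProl →ₐ[k] TrivSqZeroExt A Γ :=
  lift (TrivSqZeroExt.inlAlgHom k A Γ) (TrivSqZeroExt.inrHom A Γ |>.restrictScalars k)
    (fun a γ => TrivSqZeroExt.inl_mul_inr a γ) (fun γ a => TrivSqZeroExt.inr_mul_inl a γ)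
    (fun n a b h => by simp)

/-- The projection of the maximal prolongation onto its one-forms. -/
noncomputable def projOne : C.MaxProl →ₗ[k] Γ :=
  (TrivSqZeroExt.sndHom A Γ).restrictScalars k ∘ₗ (trunc C).toLinearMap

theorem trunc_inl (a : A) : trunc C (inl C a) = TrivSqZeroExt.inl a :=
  lift_inl _ _ _ _ _ a

theorem trunc_inr (γ : Γ) : trunc C (inr C γ) = TrivSqZeroExt.inr γ :=
  lift_inr _ _ _ _ _ γ

theorem inl_injective : Function.Injective (inl C) := fun a b h => by
  have := congrArg (trunc C) h
  rw [trunc_inl, trunc_inl] at this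
  exact TrivSqZeroExt.inl_injective this

theorem projOne_inr (γ : Γ) : projOne C (inr C γ) = γ := by
  simp [projOne, trunc_inr]

theorem projOne_of_mem (n : ℕ) (hn : n ≠ 1) {x : C.MaxProl} (hx : x ∈ deg C n) :
    projOne C x = 0 := by
  match n, hn with
  | 0, _ =>
    rw [deg_zero] at hx
    obtain ⟨a, rfl⟩ := hx
    simp [projOne, trunc_inl]
  | m + 2, _ =>
    rw [deg, pow_add, ← mul_assoc, pow_two] at hx
    refine Submodule.mul_induction_on hx ?_ (fun x y hx hy => by rw [map_add, hx, hy, add_zero])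
    intro x _ y hy
    refine Submodule.mul_induction_on hy ?_
      (fun y z hy hz => by rw [mul_add, map_add, hy, hz, add_zero])
    rintro _ ⟨γ, rfl⟩ _ ⟨γ', rfl⟩
    simp [projOne, trunc_inr]


end MaxProl
end FirstOrderCalculus
end MaximalProlongation

/-! ### Differential calculi -/

section Calculus

variable (k : Type*) [Field k] (A : Type*) [Ring A] [Algebra k A]
  {Ω : Type*} [Ring Ω] [Algebra k Ω]

/-- A differential calculus on the `k`-algebra `A`: a differential graded algebra
`Ω = ⨁ n, 𝒜 n` with `𝒜 0 = A` in which `𝒜 n` is spanned by the forms `a₀ d a₁ ⋯ d aₙ`. -/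
structure DifferentialCalculus (𝒜 : ℕ → Submodule k Ω) [GradedAlgebra 𝒜] where
  /-- The identification of `A` with the forms of degree zero. -/
  ι : A →ₐ[k] Ω
  /-- The differential. -/
  d : Ω →ₗ[k] Ω
  ι_injective : Function.Injective ι
  deg_eq : ∀ n, 𝒜 n =
    LinearMap.range ι.toLinearMap * LinearMap.range (d ∘ₗ ι.toLinearMap) ^ n
  d_mem : ∀ n, ∀ ω ∈ 𝒜 n, d ω ∈ 𝒜 (n + 1)
  d_d : ∀ ω, d (d ω) = 0
  leibniz : ∀ n, ∀ ω ∈ 𝒜 n, ∀ η, d (ω * η) = d ω * η + (-1 : k) ^ n • (ω * d η)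

end Calculus

namespace DifferentialCalculus

variable {k : Type*} [Field k] {A : Type*} [Ring A] [Algebra k A]
  {Ω : Type*} [Ring Ω] [Algebra k Ω] {𝒜 : ℕ → Submodule k Ω} [GradedAlgebra 𝒜]

theorem range_ι (D : DifferentialCalculus k A 𝒜) : LinearMap.range D.ι.toLinearMap = 𝒜 0 := by
  rw [D.deg_eq 0, pow_zero, mul_one]

theorem ι_mem (D : DifferentialCalculus k A 𝒜) (a : A) : D.ι a ∈ 𝒜 0 := by
  rw [← D.range_ι]
  exact ⟨a, rfl⟩

/-- The identification `A = Ω⁰`. -/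
noncomputable def zeroEquiv (D : DifferentialCalculus k A 𝒜) : A ≃ₗ[k] 𝒜 0 :=
  LinearEquiv.ofInjective D.ι.toLinearMap D.ι_injective ≪≫ₗ LinearEquiv.ofEq _ _ D.range_ι

/-- The projection of a form onto its component of degree zero, as an element of `A`. -/
noncomputable def projZero (D : DifferentialCalculus k A 𝒜) : Ω →ₗ[k] A :=
  D.zeroEquiv.symm.toLinearMap ∘ₗ DirectSum.component k ℕ (fun n => 𝒜 n) 0 ∘ₗ
    (DirectSum.decomposeLinearEquiv 𝒜).toLinearMap

theorem projZero_ι (D : DifferentialCalculus k A 𝒜) (a : A) : D.projZero (D.ι a) = a := by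
  have h : DirectSum.decompose 𝒜 (D.ι a) = DirectSum.of (fun n => 𝒜 n) 0 ⟨D.ι a, D.ι_mem a⟩ :=
    DirectSum.decompose_of_mem 𝒜 (D.ι_mem a)
  have h' : D.projZero (D.ι a) =
      D.zeroEquiv.symm ((DirectSum.decompose 𝒜 (D.ι a)) 0) := rfl
  rw [h', h, DirectSum.of_eq_same, LinearEquiv.symm_apply_eq]
  rfl

end DifferentialCalculus

namespace FirstOrderCalculus

variable {k : Type*} [Field k] {A : Type*} [Ring A] [Algebra k A]
  {Γ : Type*} [AddCommGroup Γ] [Module k Γ] [Module A Γ] [Module Aᵐᵒᵖ Γ]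
  [IsScalarTower k A Γ] [IsScalarTower k Aᵐᵒᵖ Γ] [SMulCommClass A Aᵐᵒᵖ Γ]

/-- The maximal prolongation as a differential calculus. -/
noncomputable def maximalProlongation (C : FirstOrderCalculus k A Γ) :
    DifferentialCalculus k A (MaxProl.deg C) where
  ι := MaxProl.inl C
  d := MaxProl.dMap C
  ι_injective := MaxProl.inl_injective C
  deg_eq := MaxProl.deg_eq C
  d_mem n _ h := MaxProl.dMap_mem C n h
  d_d := MaxProl.dMap_dMap C
  leibniz n ω h η := by
    rw [MaxProl.dMap_mul, MaxProl.signHom_of_mem C n h, smul_mul_assoc]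

end FirstOrderCalculus

/-! ### The graded tensor product of differential calculi -/

section Tensor

variable {k : Type*} [Field k] {Ω : Type*} [Ring Ω] [Algebra k Ω]

/-- The sign map `ω ↦ (-1)^|ω| ω`. -/
noncomputable def signMap (𝒜 : ℕ → Submodule k Ω) [GradedAlgebra 𝒜] : Ω →ₗ[k] Ω :=
  DirectSum.toModule k ℕ Ω (fun n => (-1 : k) ^ n • (𝒜 n).subtype) ∘ₗ
    (DirectSum.decomposeLinearEquiv 𝒜).toLinearMap

theorem signMap_of_mem (𝒜 : ℕ → Submodule k Ω) [GradedAlgebra 𝒜] (n : ℕ) {ω : Ω} (h : ω ∈ 𝒜 n) :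
    signMap 𝒜 ω = (-1 : k) ^ n • ω := by
  have h' : signMap 𝒜 ω = DirectSum.toModule k ℕ Ω (fun n => (-1 : k) ^ n • (𝒜 n).subtype)
    (DirectSum.decompose 𝒜 ω) := rfl
  rw [h', DirectSum.decompose_of_mem 𝒜 h]
  exact DirectSum.toModule_lof k n _

variable {A : Type*} [Ring A] [Algebra k A] {𝒜 : ℕ → Submodule k Ω} [GradedAlgebra 𝒜]
  {H : Type*} [Ring H] [Algebra k H] {Ω' : Type*} [Ring Ω'] [Algebra k Ω']
  {ℬ : ℕ → Submodule k Ω'} [GradedAlgebra ℬ]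

/-- The differential `d (ω ⊗ η) = d ω ⊗ η + (-1)^|ω| ω ⊗ d η` of the graded tensor product. -/
noncomputable def dTensor (D : DifferentialCalculus k A 𝒜) (E : DifferentialCalculus k H ℬ) :
    𝒜 ᵍ⊗[k] ℬ →ₗ[k] 𝒜 ᵍ⊗[k] ℬ :=
  (GradedTensorProduct.of k 𝒜 ℬ).toLinearMap ∘ₗ
    (TensorProduct.map D.d LinearMap.id + TensorProduct.map (signMap 𝒜) E.d) ∘ₗ
      (GradedTensorProduct.of k 𝒜 ℬ).symm.toLinearMap

variable (𝒜 ℬ) in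
/-- The subspace `Ω^p ⊗ Ω'^q` of the graded tensor product. -/
noncomputable def bidegree (p q : ℕ) : Submodule k (𝒜 ᵍ⊗[k] ℬ) :=
  (LinearMap.range (TensorProduct.mapIncl (𝒜 p) (ℬ q))).map
    (GradedTensorProduct.of k 𝒜 ℬ).toLinearMap

variable (𝒜 ℬ) in
/-- The subspace `Ω ⊗ Ω'^0` of the graded tensor product. -/
noncomputable def horizontalDegree : Submodule k (𝒜 ᵍ⊗[k] ℬ) :=
  (LinearMap.range (TensorProduct.map (LinearMap.id : Ω →ₗ[k] Ω) (ℬ 0).subtype)).map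
    (GradedTensorProduct.of k 𝒜 ℬ).toLinearMap

end Tensor

/-! ### Quantum principal bundles -/

section Comodule

variable (k : Type*) [Field k] (H : Type*) [Ring H] [Bialgebra k H] (A : Type*) [Ring A]
  [Algebra k A]

/-- The structure of a right `H`-comodule algebra on `A`. -/
structure RightComoduleAlgebra where
  /-- The coaction. -/
  coact : A →ₐ[k] A ⊗[k] H
  coassoc : (TensorProduct.assoc k A H H).toLinearMap ∘ₗ
      LinearMap.rTensor H coact.toLinearMap ∘ₗ coact.toLinearMap =
    LinearMap.lTensor A Coalgebra.comul ∘ₗ coact.toLinearMap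
  counit : (TensorProduct.rid k A).toLinearMap ∘ₗ
    LinearMap.lTensor A Coalgebra.counit ∘ₗ coact.toLinearMap = LinearMap.id

end Comodule

section Balanced

variable (B : Type*) [Ring B] (X : Type*) [AddCommGroup X] [Module Bᵐᵒᵖ X]
  (Y : Type*) [AddCommGroup Y] [Module B Y]

/-- The relations `x b ⊗ y - x ⊗ b y` of the tensor product over `B`. -/
def balancedRel : AddSubgroup (X ⊗[ℤ] Y) :=
  AddSubgroup.closure {t | ∃ (x : X) (b : B) (y : Y), t = (op b • x) ⊗ₜ[ℤ] y - x ⊗ₜ[ℤ] (b • y)}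

/-- The tensor product `X ⊗_B Y` of a right module with a left module over the (noncommutative)
ring `B`. -/
abbrev BalancedTensor : Type _ := (X ⊗[ℤ] Y) ⧸ balancedRel B X Y

variable {X} {X' : Type*} [AddCommGroup X'] [Module Bᵐᵒᵖ X']

/-- The map `f ⊗_B id`. -/
noncomputable def BalancedTensor.map (f : X →ₗ[Bᵐᵒᵖ] X') :
    BalancedTensor B X Y →+ BalancedTensor B X' Y :=
  QuotientAddGroup.map (balancedRel B X Y) (balancedRel B X' Y)
    (LinearMap.rTensor Y f.toAddMonoidHom.toIntLinearMap).toAddMonoidHom (by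
      rw [balancedRel, AddSubgroup.closure_le]
      rintro _ ⟨x, b, y, rfl⟩
      refine AddSubgroup.subset_closure ⟨f x, b, y, ?_⟩
      simp)

/-- Faithful flatness of the left `B`-module `Y`: a sequence `0 → X₁ → X₂ → X₃ → 0` of right
`B`-modules is short exact if and only if `0 → X₁ ⊗_B Y → X₂ ⊗_B Y → X₃ ⊗_B Y → 0` is. -/
def IsFaithfullyFlat.{u, v} (B : Type u) [Ring B] (Y : Type v) [AddCommGroup Y] [Module B Y] : Prop :=
  ∀ (X₁ X₂ X₃ : Type u) [AddCommGroup X₁] [AddCommGroup X₂] [AddCommGroup X₃]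
    [Module Bᵐᵒᵖ X₁] [Module Bᵐᵒᵖ X₂] [Module Bᵐᵒᵖ X₃]
    (f : X₁ →ₗ[Bᵐᵒᵖ] X₂) (g : X₂ →ₗ[Bᵐᵒᵖ] X₃),
    (Function.Injective f ∧ Function.Exact f g ∧ Function.Surjective g) ↔
      (Function.Injective (BalancedTensor.map B Y f) ∧
        Function.Exact (BalancedTensor.map B Y f) (BalancedTensor.map B Y g) ∧
        Function.Surjective (BalancedTensor.map B Y g))

end Balanced

namespace RightComoduleAlgebra

variable {k : Type*} [Field k] {H : Type*} [Ring H] [Bialgebra k H] {A : Type*} [Ring A]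
  [Algebra k A]

/-- The subalgebra `B = A^{co H}` of coinvariants. -/
def coinvariants (Δ : RightComoduleAlgebra k H A) : Subalgebra k A :=
  AlgHom.equalizer Δ.coact (Algebra.TensorProduct.includeLeft : A →ₐ[k] A ⊗[k] H)

/-- The right module structure of `A` over `B`, by right multiplication. -/
noncomputable instance rightModule (Δ : RightComoduleAlgebra k H A) :
    Module (Δ.coinvariants)ᵐᵒᵖ A :=
  Module.compHom A (RingHom.op (Δ.coinvariants.val : Δ.coinvariants →+* A))

theorem op_smul_def (Δ : RightComoduleAlgebra k H A) (b : Δ.coinvariants) (a : A) :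
    op b • a = a * (b : A) := rfl

/-- The map `a ⊗ a' ↦ a a'₀ ⊗ a'₁` on the tensor product over `ℤ`. -/
noncomputable def canonicalLift (Δ : RightComoduleAlgebra k H A) : A ⊗[ℤ] A →ₗ[ℤ] A ⊗[k] H :=
  LinearMap.mul' ℤ (A ⊗[k] H) ∘ₗ
    TensorProduct.map
      (Algebra.TensorProduct.includeLeft :
        A →ₐ[k] A ⊗[k] H).toRingHom.toAddMonoidHom.toIntLinearMap
      Δ.coact.toRingHom.toAddMonoidHom.toIntLinearMap

theorem canonicalLift_tmul (Δ : RightComoduleAlgebra k H A) (a a' : A) :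
    Δ.canonicalLift (a ⊗ₜ a') = (a ⊗ₜ 1) * Δ.coact a' := rfl

/-- The canonical map `χ : A ⊗_B A → A ⊗ H`, `a ⊗_B a' ↦ a a'₀ ⊗ a'₁`. -/
noncomputable def canonicalMap (Δ : RightComoduleAlgebra k H A) :
    BalancedTensor Δ.coinvariants A A →+ A ⊗[k] H :=
  QuotientAddGroup.lift (balancedRel Δ.coinvariants A A) Δ.canonicalLift.toAddMonoidHom (by
    rw [balancedRel, AddSubgroup.closure_le]
    rintro _ ⟨x, b, y, rfl⟩
    have hb : Δ.coact (b : A) = (b : A) ⊗ₜ 1 := b.2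
    change Δ.canonicalLift ((op b • x) ⊗ₜ[ℤ] y - x ⊗ₜ[ℤ] (b • y)) = 0
    rw [map_sub, canonicalLift_tmul, canonicalLift_tmul, op_smul_def, Subalgebra.smul_def,
      smul_eq_mul, map_mul, hb, ← mul_assoc, Algebra.TensorProduct.tmul_mul_tmul, mul_one,
      sub_self])

/-- `B = A^{co H} ⊆ A` is a quantum principal bundle, that is, a faithfully flat Hopf-Galois
extension: the canonical map is bijective and `A` is a faithfully flat left `B`-module. -/
structure IsQuantumPrincipalBundle (Δ : RightComoduleAlgebra k H A) : Prop where
  hopfGalois : Function.Bijective Δ.canonicalMap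
  faithfullyFlat : IsFaithfullyFlat Δ.coinvariants A

end RightComoduleAlgebra

/-! ### Covariant first order calculi on a Hopf algebra -/

section Actions

variable (k : Type*) [Field k] (H : Type*) [Ring H] [Algebra k H] (Γ : Type*) [AddCommGroup Γ]
  [Module k Γ] [Module H Γ] [Module Hᵐᵒᵖ Γ] [IsScalarTower k H Γ] [IsScalarTower k Hᵐᵒᵖ Γ]

/-- The left action `h ↦ γ ↦ h γ`. -/
def leftMul : H →ₗ[k] Γ →ₗ[k] Γ := (Algebra.lsmul k k Γ).toLinearMap

/-- The right action `h ↦ γ ↦ γ h`. -/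
def rightMul : H →ₗ[k] Γ →ₗ[k] Γ :=
  (Algebra.lsmul k k Γ : Hᵐᵒᵖ →ₐ[k] Module.End k Γ).toLinearMap ∘ₗ
    (opLinearEquiv k : H ≃ₗ[k] Hᵐᵒᵖ).toLinearMap

@[simp] theorem leftMul_apply (h : H) (γ : Γ) : leftMul k H Γ h γ = h • γ := rfl

@[simp] theorem rightMul_apply (h : H) (γ : Γ) : rightMul k H Γ h γ = op h • γ := rfl

end Actions

section Covariant

variable {k : Type*} [Field k] {H : Type*} [Ring H] [Bialgebra k H] {Γ : Type*} [AddCommGroup Γ]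
  [Module k Γ] [Module H Γ] [Module Hᵐᵒᵖ Γ] [IsScalarTower k H Γ] [IsScalarTower k Hᵐᵒᵖ Γ]

/-- A left coaction `γ ↦ γ₋₁ ⊗ γ₀` making `(Γ, d)` a left covariant calculus. -/
structure LeftCovariant (C : FirstOrderCalculus k H Γ) where
  /-- The coaction. -/
  coact : Γ →ₗ[k] H ⊗[k] Γ
  coassoc : (TensorProduct.assoc k H H Γ).toLinearMap ∘ₗ
      LinearMap.rTensor Γ Coalgebra.comul ∘ₗ coact = LinearMap.lTensor H coact ∘ₗ coact
  counit : (TensorProduct.lid k Γ).toLinearMap ∘ₗ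
    LinearMap.rTensor Γ Coalgebra.counit ∘ₗ coact = LinearMap.id
  /-- `Δ(h γ) = h₁ γ₋₁ ⊗ h₂ γ₀` -/
  coact_smul : ∀ (h : H) (γ : Γ), coact (h • γ) =
    TensorProduct.map₂ (LinearMap.mul k H) (leftMul k H Γ) (Coalgebra.comul h) (coact γ)
  /-- `Δ(γ h) = γ₋₁ h₁ ⊗ γ₀ h₂` -/
  coact_op_smul : ∀ (h : H) (γ : Γ), coact (op h • γ) =
    TensorProduct.map₂ (LinearMap.mul k H).flip (rightMul k H Γ) (Coalgebra.comul h) (coact γ)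
  coact_d : ∀ h : H, coact (C.d h) = LinearMap.lTensor H C.d (Coalgebra.comul h)

/-- A right coaction `γ ↦ γ₀ ⊗ γ₁` making `(Γ, d)` a right covariant calculus. -/
structure RightCovariant (C : FirstOrderCalculus k H Γ) where
  /-- The coaction. -/
  coact : Γ →ₗ[k] Γ ⊗[k] H
  coassoc : (TensorProduct.assoc k Γ H H).toLinearMap ∘ₗ
      LinearMap.rTensor H coact ∘ₗ coact = LinearMap.lTensor Γ Coalgebra.comul ∘ₗ coact
  counit : (TensorProduct.rid k Γ).toLinearMap ∘ₗ
    LinearMap.lTensor Γ Coalgebra.counit ∘ₗ coact = LinearMap.id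
  /-- `Δ(h γ) = h₁ γ₀ ⊗ h₂ γ₁` -/
  coact_smul : ∀ (h : H) (γ : Γ), coact (h • γ) =
    TensorProduct.map₂ (leftMul k H Γ) (LinearMap.mul k H) (Coalgebra.comul h) (coact γ)
  /-- `Δ(γ h) = γ₀ h₁ ⊗ γ₁ h₂` -/
  coact_op_smul : ∀ (h : H) (γ : Γ), coact (op h • γ) =
    TensorProduct.map₂ (rightMul k H Γ) (LinearMap.mul k H).flip (Coalgebra.comul h) (coact γ)
  coact_d : ∀ h : H, coact (C.d h) = LinearMap.rTensor H C.d (Coalgebra.comul h)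

end Covariant

namespace LeftCovariant

variable {k : Type*} [Field k] {H : Type*} [Ring H] [HopfAlgebra k H] {Γ : Type*}
  [AddCommGroup Γ] [Module k Γ] [Module H Γ] [Module Hᵐᵒᵖ Γ] [IsScalarTower k H Γ]
  [IsScalarTower k Hᵐᵒᵖ Γ] [SMulCommClass H Hᵐᵒᵖ Γ] {C : FirstOrderCalculus k H Γ}

/-- The space `Λ¹` of left coinvariant one-forms, `γ₋₁ ⊗ γ₀ = 1 ⊗ γ`. -/
def coinvariantForms (L : LeftCovariant C) : Submodule k Γ :=
  LinearMap.eqLocus L.coact (TensorProduct.mk k H Γ 1)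

/-- The map `γ ↦ S(γ₋₁) γ₀`, with values in `Γ`. -/
noncomputable def invMap (L : LeftCovariant C) : Γ →ₗ[k] Γ :=
  TensorProduct.lift (leftMul k H Γ) ∘ₗ LinearMap.rTensor Γ (HopfAlgebra.antipode k) ∘ₗ L.coact

section Convolution

variable {V : Type*} [AddCommGroup V] [Module k V]

/-- The map `γ ↦ φ(γ₋₁) (F γ₀)`. -/
noncomputable def act (L : LeftCovariant C) (φ : H →ₗ[k] Module.End k V) (F : Γ →ₗ[k] V) :
    Γ →ₗ[k] V :=
  TensorProduct.lift φ ∘ₗ LinearMap.lTensor H F ∘ₗ L.coact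

theorem act_act (L : LeftCovariant C) (φ ψ : H →ₗ[k] Module.End k V) (F : Γ →ₗ[k] V)
    (h : LinearMap.mul' k (Module.End k V) ∘ₗ TensorProduct.map φ ψ ∘ₗ Coalgebra.comul =
      Algebra.linearMap k (Module.End k V) ∘ₗ Coalgebra.counit) :
    L.act φ (L.act ψ F) = F := by
  let G : H ⊗[k] (H ⊗[k] Γ) →ₗ[k] V :=
    TensorProduct.lift φ ∘ₗ LinearMap.lTensor H (TensorProduct.lift ψ ∘ₗ LinearMap.lTensor H F)
  have h1 : L.act φ (L.act ψ F) = G ∘ₗ LinearMap.lTensor H L.coact ∘ₗ L.coact := by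
    have h0 : LinearMap.lTensor H (L.act ψ F) =
        LinearMap.lTensor H (TensorProduct.lift ψ ∘ₗ LinearMap.lTensor H F) ∘ₗ
          LinearMap.lTensor H L.coact := by
      rw [← LinearMap.lTensor_comp]
      rfl
    rw [act, h0]
    rfl
  have h2 : G ∘ₗ (TensorProduct.assoc k H H Γ).toLinearMap ∘ₗ
      LinearMap.rTensor Γ Coalgebra.comul =
      F ∘ₗ (TensorProduct.lid k Γ).toLinearMap ∘ₗ LinearMap.rTensor Γ Coalgebra.counit := by
    refine TensorProduct.ext' fun x γ => ?_
    have h3 : ∀ t : H ⊗[k] H, G ((TensorProduct.assoc k H H Γ) (t ⊗ₜ γ)) =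
        (LinearMap.mul' k (Module.End k V) (TensorProduct.map φ ψ t)) (F γ) := by
      intro t
      induction t with
      | zero => simp
      | tmul a b => simp [G]
      | add a b ha hb => rw [TensorProduct.add_tmul, map_add, map_add, ha, hb]; simp
    have h4 := LinearMap.congr_fun h x
    simp only [LinearMap.comp_apply] at h4
    simp only [LinearMap.comp_apply, LinearMap.rTensor_tmul, LinearEquiv.coe_coe]
    rw [h3, h4]
    simp [Algebra.algebraMap_eq_smul_one]
  rw [h1, ← L.coassoc, ← LinearMap.comp_assoc, ← LinearMap.comp_assoc,
    LinearMap.comp_assoc _ _ G, h2, LinearMap.comp_assoc, LinearMap.comp_assoc, L.counit,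
    LinearMap.comp_id]

theorem act_antipode_act (L : LeftCovariant C) (ρ : H →ₐ[k] Module.End k V) (F : Γ →ₗ[k] V) :
    L.act (ρ.toLinearMap ∘ₗ HopfAlgebra.antipode k) (L.act ρ.toLinearMap F) = F := by
  refine act_act L _ _ F ?_
  rw [← LinearMap.comp_assoc]
  have h : LinearMap.mul' k (Module.End k V) ∘ₗ
      TensorProduct.map (ρ.toLinearMap ∘ₗ HopfAlgebra.antipode k) ρ.toLinearMap =
      ρ.toLinearMap ∘ₗ LinearMap.mul' k H ∘ₗ LinearMap.rTensor H (HopfAlgebra.antipode k) := by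
    ext a b; simp
  rw [h, LinearMap.comp_assoc, LinearMap.comp_assoc, HopfAlgebra.mul_antipode_rTensor_comul]
  ext a; simp

theorem act_act_antipode (L : LeftCovariant C) (ρ : H →ₐ[k] Module.End k V) (F : Γ →ₗ[k] V) :
    L.act ρ.toLinearMap (L.act (ρ.toLinearMap ∘ₗ HopfAlgebra.antipode k) F) = F := by
  refine act_act L _ _ F ?_
  rw [← LinearMap.comp_assoc]
  have h : LinearMap.mul' k (Module.End k V) ∘ₗ
      TensorProduct.map ρ.toLinearMap (ρ.toLinearMap ∘ₗ HopfAlgebra.antipode k) =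
      ρ.toLinearMap ∘ₗ LinearMap.mul' k H ∘ₗ LinearMap.lTensor H (HopfAlgebra.antipode k) := by
    ext a b; simp
  rw [h, LinearMap.comp_assoc, LinearMap.comp_assoc, HopfAlgebra.mul_antipode_lTensor_comul]
  ext a; simp

end Convolution

theorem act_invMap (L : LeftCovariant C) : L.act (leftMul k H Γ) L.invMap = LinearMap.id := by
  have h : L.invMap = L.act ((Algebra.lsmul k k Γ : H →ₐ[k] Module.End k Γ).toLinearMap ∘ₗ
      HopfAlgebra.antipode k) LinearMap.id := by
    rw [act, invMap, ← LinearMap.comp_assoc, ← LinearMap.comp_assoc]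
    congr 1
    ext a γ; simp
  rw [h]
  exact act_act_antipode L _ _

/-- The diagonal action of `H` on `H ⊗ Γ`. -/
noncomputable def diagonal (k H Γ : Type*) [Field k] [Ring H] [HopfAlgebra k H]
    [AddCommGroup Γ] [Module k Γ] [Module H Γ] [IsScalarTower k H Γ] :
    H →ₐ[k] Module.End k (H ⊗[k] Γ) :=
  Module.endTensorEndAlgHom.comp
    ((Algebra.TensorProduct.map (Algebra.lmul k H) (Algebra.lsmul k k Γ)).comp
      (Bialgebra.comulAlgHom k H))

theorem diagonal_apply (h : H) (t : H ⊗[k] Γ) : diagonal k H Γ h t =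
    TensorProduct.map₂ (LinearMap.mul k H) (leftMul k H Γ) (Coalgebra.comul h) t := by
  have h1 : ∀ s : H ⊗[k] H, Module.endTensorEndAlgHom (R := k) (S := k) (A := k)
      (Algebra.TensorProduct.map (Algebra.lmul k H) (Algebra.lsmul k k Γ) s) =
      TensorProduct.map₂ (LinearMap.mul k H) (leftMul k H Γ) s := by
    intro s
    induction s with
    | zero => simp
    | tmul a b =>
      refine TensorProduct.ext' fun x γ => ?_
      simp [Module.endTensorEndAlgHom_apply]
    | add a b ha hb => rw [map_add, map_add, map_add, ha, hb]
  exact LinearMap.congr_fun (h1 (Coalgebra.comul h)) t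

theorem invMap_mem (L : LeftCovariant C) (γ : Γ) : L.invMap γ ∈ L.coinvariantForms := by
  have h1 : L.act (diagonal k H Γ).toLinearMap (L.coact ∘ₗ L.invMap) = L.coact := by
    have h : L.act (diagonal k H Γ).toLinearMap (L.coact ∘ₗ L.invMap) =
        L.coact ∘ₗ L.act (leftMul k H Γ) L.invMap := by
      rw [act, act, ← LinearMap.comp_assoc, ← LinearMap.comp_assoc, ← LinearMap.comp_assoc]
      congr 1
      refine TensorProduct.ext' fun x γ => ?_
      simp [diagonal_apply, L.coact_smul]
    rw [h, act_invMap, LinearMap.comp_id]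
  have h2 : L.act (diagonal k H Γ).toLinearMap (TensorProduct.mk k H Γ 1 ∘ₗ L.invMap) =
      L.coact := by
    have h3 : TensorProduct.lift (diagonal k H Γ).toLinearMap ∘ₗ
        LinearMap.lTensor H (TensorProduct.mk k H Γ 1 ∘ₗ L.invMap) =
        LinearMap.lTensor H (TensorProduct.lift (leftMul k H Γ) ∘ₗ
          LinearMap.lTensor H L.invMap) ∘ₗ
        (TensorProduct.assoc k H H Γ).toLinearMap ∘ₗ LinearMap.rTensor Γ Coalgebra.comul := by
      refine TensorProduct.ext' fun x γ => ?_
      have h4 : ∀ s : H ⊗[k] H, TensorProduct.map₂ (LinearMap.mul k H) (leftMul k H Γ) s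
          (1 ⊗ₜ L.invMap γ) = LinearMap.lTensor H (TensorProduct.lift (leftMul k H Γ) ∘ₗ
          LinearMap.lTensor H L.invMap) (TensorProduct.assoc k H H Γ (s ⊗ₜ γ)) := by
        intro s
        induction s with
        | zero => simp
        | tmul a b => simp
        | add a b ha hb =>
          rw [TensorProduct.add_tmul, map_add, map_add, map_add, ← ha, ← hb]; rfl
      simp only [LinearMap.comp_apply, LinearMap.lTensor_tmul, TensorProduct.lift.tmul,
        LinearMap.rTensor_tmul, LinearEquiv.coe_coe, AlgHom.toLinearMap_apply, diagonal_apply,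
        TensorProduct.mk_apply]
      exact h4 _
    rw [act, ← LinearMap.comp_assoc, h3, LinearMap.comp_assoc, LinearMap.comp_assoc, L.coassoc,
      ← LinearMap.comp_assoc, ← LinearMap.lTensor_comp, LinearMap.comp_assoc]
    have h5 := L.act_invMap
    rw [act] at h5
    rw [h5, LinearMap.lTensor_id, LinearMap.id_comp]
  have h6 : L.coact ∘ₗ L.invMap = TensorProduct.mk k H Γ 1 ∘ₗ L.invMap := by
    rw [← L.act_antipode_act (diagonal k H Γ) (L.coact ∘ₗ L.invMap), h1, ← h2,
      L.act_antipode_act]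
  exact LinearMap.congr_fun h6 γ

/-- The projection `π_inv : Γ → Λ¹`, `γ ↦ S(γ₋₁) γ₀`. -/
noncomputable def piInv (L : LeftCovariant C) : Γ →ₗ[k] L.coinvariantForms :=
  L.invMap.codRestrict L.coinvariantForms L.invMap_mem

variable (k H Γ) in
/-- The map `θ ↦ h ↦ S(h₁) θ h₂`. -/
noncomputable def adjMap : Γ →ₗ[k] H →ₗ[k] Γ :=
  LinearMap.mk₂ k
    (fun θ h => TensorProduct.lift ((leftMul k H Γ).compl₁₂ (HopfAlgebra.antipode k)
      ((rightMul k H Γ).flip θ)) (Coalgebra.comul h))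
    (fun θ θ' h => by
      simp only [map_add]
      generalize (Coalgebra.comul h : H ⊗[k] H) = s
      induction s with
      | zero => simp
      | tmul a b => simp
      | add a b ha hb => simp only [map_add, ha, hb]; abel)
    (fun r θ h => by
      generalize (Coalgebra.comul h : H ⊗[k] H) = s
      induction s with
      | zero => simp
      | tmul a b => simp
      | add a b ha hb => simp only [map_add, ha, hb, smul_add])
    (fun θ h h' => by simp)
    (fun r θ h => by simp)

theorem adjMap_mem (L : LeftCovariant C) {θ : Γ} (hθ : θ ∈ L.coinvariantForms) (h : H) :
    adjMap k H Γ θ h ∈ L.coinvariantForms := by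
  have hθ' : L.coact θ = 1 ⊗ₜ θ := hθ
  have h1 : adjMap k H Γ θ h = L.invMap (op h • θ) := by
    rw [invMap, LinearMap.comp_apply, LinearMap.comp_apply, L.coact_op_smul, hθ', adjMap,
      LinearMap.mk₂_apply]
    generalize (Coalgebra.comul h : H ⊗[k] H) = s
    induction s with
    | zero => simp
    | tmul a b => simp
    | add a b ha hb => simp only [map_add, LinearMap.add_apply, ha, hb]
  rw [h1]
  exact L.invMap_mem _

/-- The right action `θ ↼ h = S(h₁) θ h₂` of `H` on `Λ¹`. -/
noncomputable def adj (L : LeftCovariant C) :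
    L.coinvariantForms →ₗ[k] H →ₗ[k] L.coinvariantForms :=
  LinearMap.mk₂ k (fun θ h => ⟨adjMap k H Γ θ h, L.adjMap_mem θ.2 h⟩)
    (fun θ θ' h => by ext; simp) (fun r θ h => by ext; simp)
    (fun θ h h' => by ext; simp) (fun r θ h => by ext; simp)

end LeftCovariant

/-! ### Complete calculi, horizontal and vertical forms -/

section Complete

variable {k : Type*} [Field k] {H : Type*} [Ring H] [HopfAlgebra k H]
  {A : Type*} [Ring A] [Algebra k A]
  {Ω : Type*} [Ring Ω] [Algebra k Ω] {𝒜 : ℕ → Submodule k Ω} [GradedAlgebra 𝒜]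
  {Ω' : Type*} [Ring Ω'] [Algebra k Ω'] {ℬ : ℕ → Submodule k Ω'} [GradedAlgebra ℬ]

/-- An extension of the coaction `A → A ⊗ H` to a morphism of differential graded algebras
`Ω(A) → Ω(A) ⊗ Ω(H)`. -/
structure CoactionExtension (Δ : RightComoduleAlgebra k H A) (D : DifferentialCalculus k A 𝒜)
    (E : DifferentialCalculus k H ℬ) where
  /-- The extended coaction. -/
  hom : Ω →ₐ[k] 𝒜 ᵍ⊗[k] ℬ
  hom_ι : ∀ a : A, hom (D.ι a) = GradedTensorProduct.of k 𝒜 ℬ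
    (TensorProduct.map D.ι.toLinearMap E.ι.toLinearMap (Δ.coact a))
  hom_d : ∀ ω : Ω, hom (D.d ω) = dTensor D E (hom ω)
  hom_mem : ∀ n, ∀ ω ∈ 𝒜 n, hom ω ∈ ⨆ p ∈ Finset.HasAntidiagonal.antidiagonal n, bidegree 𝒜 ℬ p.1 p.2

namespace CoactionExtension

variable {Δ : RightComoduleAlgebra k H A} {D : DifferentialCalculus k A 𝒜}
  {E : DifferentialCalculus k H ℬ}

/-- The horizontal forms, the preimage of `Ω(A) ⊗ H`. -/
noncomputable def hor (X : CoactionExtension Δ D E) : Submodule k Ω :=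
  (horizontalDegree 𝒜 ℬ).comap X.hom.toLinearMap

/-- The horizontal one-forms. -/
noncomputable def horOne (X : CoactionExtension Δ D E) : Submodule k Ω := X.hor ⊓ 𝒜 1

theorem horOne_le (X : CoactionExtension Δ D E) : X.horOne ≤ 𝒜 1 := inf_le_right

end CoactionExtension

variable {Γ : Type*} [AddCommGroup Γ] [Module k Γ] [Module H Γ] [Module Hᵐᵒᵖ Γ]
  [IsScalarTower k H Γ] [IsScalarTower k Hᵐᵒᵖ Γ] [SMulCommClass H Hᵐᵒᵖ Γ]
  {C : FirstOrderCalculus k H Γ}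

/-- The vertical one-forms `A ⊗ Λ¹`, a left `A`-module by `a (b ⊗ θ) = a b ⊗ θ`. -/
abbrev VerOne (A : Type*) [Ring A] [Algebra k A] (L : LeftCovariant C) : Type _ :=
  A ⊗[k] L.coinvariantForms

/-- The right action `(b ⊗ θ) a = b a₀ ⊗ θ ↼ a₁` of `A` on the vertical one-forms. -/
noncomputable def verRightMul (Δ : RightComoduleAlgebra k H A) (L : LeftCovariant C)
    (v : VerOne A L) (a : A) : VerOne A L :=
  TensorProduct.map₂ (LinearMap.mul k A) L.adj v (Δ.coact a)

/-- The map `π_ver = (id ⊗ π_inv ∘ π₁) ∘ Δ^∧ : Ω¹(A) → A ⊗ Λ¹`, extended by zero to the other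
degrees. -/
noncomputable def piVer {Δ : RightComoduleAlgebra k H A} {D : DifferentialCalculus k A 𝒜}
    (L : LeftCovariant C) (X : CoactionExtension Δ D C.maximalProlongation) :
    Ω →ₗ[k] VerOne A L :=
  TensorProduct.map D.projZero (L.piInv ∘ₗ FirstOrderCalculus.MaxProl.projOne C) ∘ₗ
    (GradedTensorProduct.of k 𝒜 (FirstOrderCalculus.MaxProl.deg C)).symm.toLinearMap ∘ₗ
      X.hom.toLinearMap

/-- On one-forms, `piVer` is the composite `(id ⊗ π_inv ∘ π₁) ∘ Δ^∧`, which takes its values in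
`A ⊗ Λ¹`. -/
theorem piVer_spec {Δ : RightComoduleAlgebra k H A} {D : DifferentialCalculus k A 𝒜}
    (L : LeftCovariant C) (X : CoactionExtension Δ D C.maximalProlongation) {ω : Ω}
    (hω : ω ∈ 𝒜 1) :
    LinearMap.rTensor L.coinvariantForms D.ι.toLinearMap (piVer L X ω) =
      LinearMap.lTensor Ω (L.piInv ∘ₗ FirstOrderCalculus.MaxProl.projOne C)
        ((GradedTensorProduct.of k 𝒜 (FirstOrderCalculus.MaxProl.deg C)).symm (X.hom ω)) := by
  have h := X.hom_mem 1 ω hω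
  have key : ∀ t ∈ ⨆ p ∈ Finset.HasAntidiagonal.antidiagonal 1,
      bidegree 𝒜 (FirstOrderCalculus.MaxProl.deg C) p.1 p.2,
      LinearMap.rTensor L.coinvariantForms D.ι.toLinearMap
        (TensorProduct.map D.projZero (L.piInv ∘ₗ FirstOrderCalculus.MaxProl.projOne C)
          ((GradedTensorProduct.of k 𝒜 (FirstOrderCalculus.MaxProl.deg C)).symm t)) =
      LinearMap.lTensor Ω (L.piInv ∘ₗ FirstOrderCalculus.MaxProl.projOne C)
        ((GradedTensorProduct.of k 𝒜 (FirstOrderCalculus.MaxProl.deg C)).symm t) := by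
    intro t ht
    let P : Submodule k (𝒜 ᵍ⊗[k] (FirstOrderCalculus.MaxProl.deg C)) :=
      LinearMap.eqLocus
        (LinearMap.rTensor L.coinvariantForms D.ι.toLinearMap ∘ₗ
          TensorProduct.map D.projZero (L.piInv ∘ₗ FirstOrderCalculus.MaxProl.projOne C) ∘ₗ
          (GradedTensorProduct.of k 𝒜 (FirstOrderCalculus.MaxProl.deg C)).symm.toLinearMap)
        (LinearMap.lTensor Ω (L.piInv ∘ₗ FirstOrderCalculus.MaxProl.projOne C) ∘ₗ
          (GradedTensorProduct.of k 𝒜 (FirstOrderCalculus.MaxProl.deg C)).symm.toLinearMap)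
    suffices hP : ⨆ p ∈ Finset.HasAntidiagonal.antidiagonal 1,
        bidegree 𝒜 (FirstOrderCalculus.MaxProl.deg C) p.1 p.2 ≤ P from hP ht
    refine iSup₂_le fun p hp => ?_
    rintro _ ⟨_, ⟨s, rfl⟩, rfl⟩
    change LinearMap.rTensor L.coinvariantForms D.ι.toLinearMap
        (TensorProduct.map D.projZero (L.piInv ∘ₗ FirstOrderCalculus.MaxProl.projOne C)
          (TensorProduct.mapIncl _ _ s)) =
      LinearMap.lTensor Ω (L.piInv ∘ₗ FirstOrderCalculus.MaxProl.projOne C)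
        (TensorProduct.mapIncl _ _ s)
    induction s with
    | zero => simp
    | add x y hx hy => simp only [map_add, hx, hy]
    | tmul x y =>
      obtain ⟨x, hx⟩ := x
      obtain ⟨y, hy⟩ := y
      rw [Finset.HasAntidiagonal.mem_antidiagonal] at hp
      by_cases h2 : p.2 = 1
      · have h1 : p.1 = 0 := by omega
        rw [h1, ← D.range_ι] at hx
        obtain ⟨a, rfl⟩ := hx
        simp [TensorProduct.mapIncl, D.projZero_ι]
      · have := FirstOrderCalculus.MaxProl.projOne_of_mem C p.2 h2 hy
        simp [TensorProduct.mapIncl, this]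
  exact key _ h

end Complete

end QuantumBundle

/-! The extended coaction sends a one-form into Ω¹(A) ⊗ H ⊕ A ⊗ Γ. Write v(ω) for the component in A
⊗ Γ (`vertPart`). A one-form is horizontal exactly when v(ω) = 0, while π_ver(ω) = (id ⊗ π_inv)
v(ω). The work lies in showing that applying π_inv loses no information on the image of v, and that
every vertical form is reached.

No information is lost because v(ω) can be rebuilt from π_ver(ω) by a ⊗ θ ↦ a₀ ⊗ a₁θ
(`coactForm_piVer`). For ω = db one has v(db) = b₀ ⊗ db₁, and the rebuilt element is b₀ ⊗ b₁
π_inv(db₂). This equals b₀ ⊗ db₁ by left covariance of d and the identity γ₋₁ π_inv(γ₀) = γ. The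
case a db follows because both sides transform under left multiplication by a through Δ_A(a). Hence
ker π_ver = hor¹ (`mem_horOne_iff`).

Bilinearity of π_ver reduces to π_inv(hγ) = ε(h) π_inv(γ) and π_inv(γh) = π_inv(γ) ↼ h
(`piInv_smul`, `piInv_op_smul`). Stability of hor¹ under A is then stability of the kernel of a
bimodule map.

For surjectivity, π_ver(a db) = (id ⊗ π_inv ∘ d)(ab₀ ⊗ b₁), so π_ver on one-forms has the image of
the canonical map followed by id ⊗ (π_inv ∘ d). The canonical map is onto by the Hopf–Galois
condition, and π_inv ∘ d : H → Λ¹ is onto because Γ is spanned by the h dh' (`piInv_d_surjective`).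
-/

namespace QuantumBundle

/-! ### Linearity over degree zero of the projection onto one-forms. -/

namespace FirstOrderCalculus.MaxProl

variable {k : Type*} [Field k] {A : Type*} [Ring A] [Algebra k A]
  {Γ : Type*} [AddCommGroup Γ] [Module k Γ] [Module A Γ] [Module Aᵐᵒᵖ Γ]
  [IsScalarTower k A Γ] [IsScalarTower k Aᵐᵒᵖ Γ] [SMulCommClass A Aᵐᵒᵖ Γ]
  (C : FirstOrderCalculus k A Γ)

/-- `projOne` is the second component of the algebra map `trunc` into the square-zero extension,
where elements of degree zero act by the bimodule structure of `Γ`. -/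
theorem projOne_inl_mul (a : A) (x : C.MaxProl) : projOne C (inl C a * x) = a • projOne C x := by
  simp [projOne, trunc_inl]

theorem projOne_mul_inl (x : C.MaxProl) (a : A) :
    projOne C (x * inl C a) = op a • projOne C x := by
  simp [projOne, trunc_inl]

theorem projOne_inl (a : A) : projOne C (inl C a) = 0 :=
  projOne_of_mem C 0 zero_ne_one (inl_mem_deg C a)

end FirstOrderCalculus.MaxProl

/-! ### The projection onto degree zero, and generation of one-forms. -/

namespace DifferentialCalculus

variable {k : Type*} [Field k] {A : Type*} [Ring A] [Algebra k A]
  {Ω : Type*} [Ring Ω] [Algebra k Ω] {𝒜 : ℕ → Submodule k Ω} [GradedAlgebra 𝒜]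
  (D : DifferentialCalculus k A 𝒜)

theorem projZero_of_mem (n : ℕ) (hn : n ≠ 0) {x : Ω} (hx : x ∈ 𝒜 n) : D.projZero x = 0 := by
  have h : D.projZero x = D.zeroEquiv.symm ((DirectSum.decompose 𝒜 x) 0) := rfl
  rw [h, LinearEquiv.map_eq_zero_iff]
  exact Subtype.ext (DirectSum.decompose_of_mem_ne 𝒜 hx hn)

/-- A property of forms holds if it is additive and holds for homogeneous forms. -/
theorem homogeneous_induction {P : Ω → Prop} (x : Ω) (h0 : P 0)
    (hadd : ∀ x y, P x → P y → P (x + y)) (h : ∀ n, ∀ x ∈ 𝒜 n, P x) : P x :=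
  DirectSum.Decomposition.inductionOn 𝒜 h0 (fun {n} x => h n x x.2) hadd x

/-- Multiplication by a form of degree zero preserves degrees, so on homogeneous forms either both
sides vanish or the identity takes place inside `A`. -/
theorem projZero_ι_mul (a : A) (x : Ω) : D.projZero (D.ι a * x) = a * D.projZero x := by
  induction x using homogeneous_induction (𝒜 := 𝒜) with
  | h0 => simp
  | hadd x y hx hy => rw [mul_add, map_add, map_add, hx, hy, mul_add]
  | h n x hx =>
    by_cases hn : n = 0
    · subst hn
      rw [← D.range_ι] at hx
      obtain ⟨b, rfl⟩ := hx
      rw [AlgHom.toLinearMap_apply, ← map_mul, projZero_ι, projZero_ι]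
    · have := SetLike.mul_mem_graded (D.ι_mem a) hx
      rw [zero_add] at this
      rw [D.projZero_of_mem n hn hx, D.projZero_of_mem n hn this, mul_zero]

theorem projZero_mul_ι (x : Ω) (a : A) : D.projZero (x * D.ι a) = D.projZero x * a := by
  induction x using homogeneous_induction (𝒜 := 𝒜) with
  | h0 => simp
  | hadd x y hx hy => rw [add_mul, map_add, map_add, hx, hy, add_mul]
  | h n x hx =>
    by_cases hn : n = 0
    · subst hn
      rw [← D.range_ι] at hx
      obtain ⟨b, rfl⟩ := hx
      rw [AlgHom.toLinearMap_apply, ← map_mul, projZero_ι, projZero_ι]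
    · have := SetLike.mul_mem_graded hx (D.ι_mem a)
      rw [add_zero] at this
      rw [D.projZero_of_mem n hn hx, D.projZero_of_mem n hn this, zero_mul]

/-- One-forms are sums of the forms `a d b`. -/
theorem induction_one {P : Ω → Prop} {ω : Ω} (hω : ω ∈ 𝒜 1)
    (h : ∀ a b : A, P (D.ι a * D.d (D.ι b))) (hadd : ∀ x y, P x → P y → P (x + y)) : P ω := by
  rw [D.deg_eq, pow_one] at hω
  refine Submodule.mul_induction_on hω ?_ hadd
  rintro _ ⟨a, rfl⟩ _ ⟨b, rfl⟩
  exact h a b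

theorem ι_mul_mem (a : A) {ω : Ω} {n : ℕ} (hω : ω ∈ 𝒜 n) : D.ι a * ω ∈ 𝒜 n := by
  have := SetLike.mul_mem_graded (D.ι_mem a) hω
  rwa [zero_add] at this

theorem mul_ι_mem (a : A) {ω : Ω} {n : ℕ} (hω : ω ∈ 𝒜 n) : ω * D.ι a ∈ 𝒜 n := by
  have := SetLike.mul_mem_graded hω (D.ι_mem a)
  rwa [add_zero] at this

end DifferentialCalculus

/-! ### The projection onto left coinvariant forms and the two `H`-actions. -/

namespace LeftCovariant

variable {k : Type*} [Field k] {H : Type*} [Ring H] [HopfAlgebra k H] {Γ : Type*}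
  [AddCommGroup Γ] [Module k Γ] [Module H Γ] [Module Hᵐᵒᵖ Γ] [IsScalarTower k H Γ]
  [IsScalarTower k Hᵐᵒᵖ Γ] [SMulCommClass H Hᵐᵒᵖ Γ] {C : FirstOrderCalculus k H Γ}
  (L : LeftCovariant C)

/-- The antipode reverses products, so S(h₁γ₋₁) h₂γ₀ = S(γ₋₁) S(h₁)h₂ γ₀, and S(h₁)h₂ = ε(h). -/
theorem invMap_smul (h : H) (γ : Γ) :
    L.invMap (h • γ) = Coalgebra.counit (R := k) h • L.invMap γ := by
  -- The regrouping holds for arbitrary tensors in place of Δ(h) and the coaction of γ; the antipode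
  -- axiom is needed only afterwards.
  have key : ∀ (s : H ⊗[k] H) (t : H ⊗[k] Γ),
      TensorProduct.lift (leftMul k H Γ) (LinearMap.rTensor Γ (HopfAlgebra.antipode k)
        (TensorProduct.map₂ (LinearMap.mul k H) (leftMul k H Γ) s t)) =
      TensorProduct.lift (leftMul k H Γ) (TensorProduct.map (HopfAlgebra.antipode k)
        (leftMul k H Γ (LinearMap.mul' k H (LinearMap.rTensor H (HopfAlgebra.antipode k) s))) t) := by
    intro s t
    induction s with
    | zero => simp
    | add a b ha hb =>
      simp only [map_add, LinearMap.add_apply, ha, hb, TensorProduct.map_add_right]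
    | tmul a b =>
      induction t with
      | zero => simp
      | add x y hx hy => simp only [map_add, hx, hy]
      | tmul x γ => simp [HopfAlgebra.antipode_mul_antidistrib, mul_smul]
  have h1 : leftMul k H Γ (algebraMap k H (Coalgebra.counit h)) =
      Coalgebra.counit (R := k) h • LinearMap.id := by
    ext γ; simp
  rw [invMap, LinearMap.comp_apply, LinearMap.comp_apply, L.coact_smul, key,
    HopfAlgebra.mul_antipode_rTensor_comul_apply, h1, TensorProduct.map_smul_right,
    LinearMap.smul_apply, map_smul]
  rfl

/-- S(γ₋₁h₁) γ₀h₂ = S(h₁) (S(γ₋₁)γ₀) h₂, since the antipode reverses products and the left and right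
actions commute. -/
theorem invMap_op_smul (h : H) (γ : Γ) : L.invMap (op h • γ) = adjMap k H Γ (L.invMap γ) h := by
  rw [invMap, LinearMap.comp_apply, LinearMap.comp_apply, L.coact_op_smul, adjMap,
    LinearMap.mk₂_apply, LinearMap.comp_apply, LinearMap.comp_apply]
  generalize (Coalgebra.comul h : H ⊗[k] H) = s
  generalize L.coact γ = t
  induction s with
  | zero => simp
  | add a b ha hb => simp only [map_add, LinearMap.add_apply, ha, hb]
  | tmul a b =>
    induction t with
    | zero => simp
    | add x y hx hy =>
      rw [map_add, map_add, map_add, hx, hy]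
      simp
    | tmul x γ =>
      simp [HopfAlgebra.antipode_mul_antidistrib, mul_smul, smul_comm]

theorem piInv_smul (h : H) (γ : Γ) :
    L.piInv (h • γ) = Coalgebra.counit (R := k) h • L.piInv γ :=
  Subtype.ext (L.invMap_smul h γ)

theorem piInv_op_smul (h : H) (γ : Γ) : L.piInv (op h • γ) = L.adj (L.piInv γ) h :=
  Subtype.ext (L.invMap_op_smul h γ)

theorem piInv_coinvariant (θ : L.coinvariantForms) : L.piInv θ = θ := by
  have hθ : L.coact θ = 1 ⊗ₜ (θ : Γ) := θ.2
  refine Subtype.ext ?_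
  change L.invMap θ = θ
  simp [invMap, hθ]

/-- Each θ in Λ¹ is its own projection, and it is a sum of forms a db. Since π_inv(a db) = ε(a)
π_inv(db), the coefficients become scalars and are absorbed by linearity of d. -/
theorem piInv_d_surjective : Function.Surjective (L.piInv ∘ₗ C.d) := by
  intro θ
  suffices h : ∀ γ : Γ, L.piInv γ ∈ LinearMap.range (L.piInv ∘ₗ C.d) by
    simpa only [piInv_coinvariant, LinearMap.mem_range] using h θ
  intro γ
  refine FirstOrderCalculus.MaxProl.induction_form C
    (P := fun γ => L.piInv γ ∈ LinearMap.range (L.piInv ∘ₗ C.d)) γ (fun a b => ?_) (by simp)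
    (fun x y hx hy => by rw [map_add]; exact add_mem hx hy)
  rw [piInv_smul]
  exact Submodule.smul_mem _ _ ⟨b, rfl⟩

end LeftCovariant

section Complete

variable {k : Type*} [Field k] {H : Type*} [Ring H] [HopfAlgebra k H]
  {A : Type*} [Ring A] [Algebra k A]
  {Ω : Type*} [Ring Ω] [Algebra k Ω] {𝒜 : ℕ → Submodule k Ω} [GradedAlgebra 𝒜]
  {Γ : Type*} [AddCommGroup Γ] [Module k Γ] [Module H Γ] [Module Hᵐᵒᵖ Γ]
  [IsScalarTower k H Γ] [IsScalarTower k Hᵐᵒᵖ Γ] [SMulCommClass H Hᵐᵒᵖ Γ]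
  {C : FirstOrderCalculus k H Γ}

open FirstOrderCalculus

/-! ### The component of bidegree (0,1) in the graded tensor product. -/

namespace DifferentialCalculus

variable (D : DifferentialCalculus k A 𝒜) (C)

/-- The component in `A ⊗ Γ` of an element of `Ω(A) ⊗ Ω(H)`. -/
noncomputable def projZeroOne : 𝒜 ᵍ⊗[k] (MaxProl.deg C) →ₗ[k] A ⊗[k] Γ :=
  TensorProduct.map D.projZero (MaxProl.projOne C) ∘ₗ
    (GradedTensorProduct.of k 𝒜 (MaxProl.deg C)).symm.toLinearMap

/-- The inclusion of `A ⊗ H` in `Ω(A) ⊗ Ω(H)`. -/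
noncomputable def inclZeroZero : A ⊗[k] H →ₗ[k] 𝒜 ᵍ⊗[k] (MaxProl.deg C) :=
  (GradedTensorProduct.of k 𝒜 (MaxProl.deg C)).toLinearMap ∘ₗ
    TensorProduct.map D.ι.toLinearMap (MaxProl.inl C).toLinearMap

/-- Multiplication by an element of bidegree (0,0) preserves bidegrees. The Koszul sign from moving
h past x is trivial because h has degree zero. -/
theorem projZeroOne_inclZeroZero_mul (s : A ⊗[k] H) (t : 𝒜 ᵍ⊗[k] (MaxProl.deg C)) :
    projZeroOne C D (inclZeroZero C D s * t) =
      TensorProduct.map₂ (LinearMap.mul k A) (leftMul k H Γ) s (projZeroOne C D t) := by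
  induction s with
  | zero => simp
  | add a b ha hb => rw [map_add, add_mul, map_add, ha, hb, map_add, LinearMap.add_apply]
  | tmul a h =>
    obtain ⟨t, rfl⟩ := (GradedTensorProduct.of k 𝒜 (MaxProl.deg C)).surjective t
    induction t with
    | zero => simp
    | add x y hx hy => simp only [map_add, mul_add, hx, hy]
    | tmul x y =>
      -- The product formula of the graded tensor product is available once the factor x, which h
      -- has to pass, is homogeneous.
      induction x using homogeneous_induction (𝒜 := 𝒜) with
      | h0 => simp
      | hadd x x' hx hx' => simp only [TensorProduct.add_tmul, map_add, mul_add, hx, hx']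
      | h n x hx =>
        have h1 := GradedTensorProduct.tmul_zero_coe_mul_coe_tmul (R := k) 𝒜 (MaxProl.deg C)
          (D.ι a) ⟨MaxProl.inl C h, MaxProl.inl_mem_deg C h⟩ ⟨x, hx⟩ y
        have h2 := congrArg (projZeroOne C D) h1
        refine h2.trans ?_
        change D.projZero (D.ι a * x) ⊗ₜ[k] MaxProl.projOne C (MaxProl.inl C h * y) =
          (a * D.projZero x) ⊗ₜ[k] (h • MaxProl.projOne C y)
        rw [projZero_ι_mul, MaxProl.projOne_inl_mul]

theorem projZeroOne_mul_inclZeroZero (t : 𝒜 ᵍ⊗[k] (MaxProl.deg C)) (s : A ⊗[k] H) :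
    projZeroOne C D (t * inclZeroZero C D s) =
      TensorProduct.map₂ (LinearMap.mul k A) (rightMul k H Γ).flip (projZeroOne C D t) s := by
  induction s with
  | zero => simp
  | add a b ha hb => rw [map_add, mul_add, map_add, ha, hb, map_add]
  | tmul a h =>
    obtain ⟨t, rfl⟩ := (GradedTensorProduct.of k 𝒜 (MaxProl.deg C)).surjective t
    induction t with
    | zero => simp
    | add x y hx hy => simp only [map_add, add_mul, hx, hy, LinearMap.add_apply]
    | tmul x y =>
      -- Here y is the factor that passes the degree-zero element a, so y is the one to be made
      -- homogeneous.
      induction y using homogeneous_induction (𝒜 := MaxProl.deg C) with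
      | h0 => simp
      | hadd x x' hx hx' =>
        simp only [TensorProduct.tmul_add, map_add, add_mul, hx, hx', LinearMap.add_apply]
      | h n y hy =>
        have h1 := GradedTensorProduct.tmul_coe_mul_zero_coe_tmul (R := k) 𝒜 (MaxProl.deg C)
          x ⟨y, hy⟩ ⟨D.ι a, D.ι_mem a⟩ (MaxProl.inl C h)
        have h2 := congrArg (projZeroOne C D) h1
        refine h2.trans ?_
        change D.projZero (x * D.ι a) ⊗ₜ[k] MaxProl.projOne C (y * MaxProl.inl C h) =
          (D.projZero x * a) ⊗ₜ[k] (op h • MaxProl.projOne C y)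
        rw [projZero_mul_ι, MaxProl.projOne_mul_inl]

/-- In d(a ⊗ h) = da ⊗ h + a ⊗ dh the first term has bidegree (1,0) and is killed by the projection.
-/
theorem projZeroOne_dTensor_inclZeroZero (s : A ⊗[k] H) :
    projZeroOne C D (dTensor D C.maximalProlongation (inclZeroZero C D s)) =
      LinearMap.lTensor A C.d s := by
  induction s with
  | zero => simp
  | add a b ha hb => simp only [map_add, ha, hb]
  | tmul a h =>
    change TensorProduct.map D.projZero (MaxProl.projOne C)
      (D.d (D.ι a) ⊗ₜ MaxProl.inl C h + signMap 𝒜 (D.ι a) ⊗ₜ MaxProl.dMap C (MaxProl.inl C h)) =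
      a ⊗ₜ[k] C.d h
    rw [map_add, TensorProduct.map_tmul, TensorProduct.map_tmul, MaxProl.projOne_inl,
      TensorProduct.tmul_zero, zero_add, signMap_of_mem 𝒜 0 (D.ι_mem a), pow_zero, one_smul,
      projZero_ι, MaxProl.dMap_inl, MaxProl.projOne_inr]

theorem projZeroOne_of_horizontal {t : 𝒜 ᵍ⊗[k] (MaxProl.deg C)}
    (ht : t ∈ horizontalDegree 𝒜 (MaxProl.deg C)) : projZeroOne C D t = 0 := by
  obtain ⟨_, ⟨s, rfl⟩, rfl⟩ := ht
  change TensorProduct.map D.projZero (MaxProl.projOne C)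
    (TensorProduct.map LinearMap.id (MaxProl.deg C 0).subtype s) = 0
  induction s with
  | zero => simp
  | add a b ha hb => simp only [map_add, ha, hb, add_zero]
  | tmul x y => simp [MaxProl.projOne_of_mem C 0 zero_ne_one y.2]

/-- In total degree one the available bidegrees are (0,1) and (1,0). Once the first component
vanishes, what is left lies in Ω¹(A) ⊗ H. -/
theorem horizontal_of_projZeroOne {t : 𝒜 ᵍ⊗[k] (MaxProl.deg C)}
    (ht : t ∈ ⨆ p ∈ Finset.HasAntidiagonal.antidiagonal 1,
      bidegree 𝒜 (MaxProl.deg C) p.1 p.2)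
    (h0 : projZeroOne C D t = 0) : t ∈ horizontalDegree 𝒜 (MaxProl.deg C) := by
  let Q : A ⊗[k] Γ →ₗ[k] 𝒜 ᵍ⊗[k] (MaxProl.deg C) :=
    (GradedTensorProduct.of k 𝒜 (MaxProl.deg C)).toLinearMap ∘ₗ
      TensorProduct.map D.ι.toLinearMap (MaxProl.inr C)
  -- `Q` puts A ⊗ Γ back as the summand of bidegree (0,1), so t − Q(`projZeroOne` t) should be
  -- horizontal for every t of total degree one. This is a linear condition and can be checked on
  -- each bidegree.
  suffices h : ⨆ p ∈ Finset.HasAntidiagonal.antidiagonal 1, bidegree 𝒜 (MaxProl.deg C) p.1 p.2 ≤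
      (horizontalDegree 𝒜 (MaxProl.deg C)).comap (LinearMap.id - Q ∘ₗ projZeroOne C D) by
    have := h ht
    rwa [Submodule.mem_comap, LinearMap.sub_apply, LinearMap.comp_apply, h0, map_zero,
      LinearMap.id_apply, sub_zero] at this
  refine iSup₂_le fun p hp => ?_
  rintro _ ⟨_, ⟨s, rfl⟩, rfl⟩
  rw [Finset.HasAntidiagonal.mem_antidiagonal] at hp
  induction s with
  | zero => simp
  | add x y hx hy => rw [map_add, map_add]; exact add_mem hx hy
  | tmul x y =>
    obtain ⟨x, hx⟩ := x
    obtain ⟨y, hy⟩ := y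
    rw [Submodule.mem_comap]
    change GradedTensorProduct.of k 𝒜 (MaxProl.deg C) (x ⊗ₜ y) -
      Q (D.projZero x ⊗ₜ MaxProl.projOne C y) ∈ _
    by_cases h2 : p.2 = 1
    · have h1 : p.1 = 0 := by omega
      rw [h1, ← D.range_ι] at hx
      obtain ⟨a, rfl⟩ := hx
      rw [h2, MaxProl.deg_one] at hy
      obtain ⟨γ, rfl⟩ := hy
      rw [AlgHom.toLinearMap_apply, projZero_ι, MaxProl.projOne_inr]
      rw [show Q (a ⊗ₜ γ) = GradedTensorProduct.of k 𝒜 (MaxProl.deg C)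
        (D.ι a ⊗ₜ MaxProl.inr C γ) from rfl, sub_self]
      exact zero_mem _
    · have h1 : p.2 = 0 := by omega
      rw [MaxProl.projOne_of_mem C p.2 h2 hy, TensorProduct.tmul_zero, map_zero, sub_zero]
      rw [h1] at hy
      exact ⟨_, ⟨x ⊗ₜ ⟨y, hy⟩, rfl⟩, rfl⟩

end DifferentialCalculus

theorem verRightMul_zero (Δ : RightComoduleAlgebra k H A) (L : LeftCovariant C) (a : A) :
    verRightMul Δ L 0 a = 0 := by
  rw [verRightMul, map_zero, LinearMap.zero_apply]

/-! ### The vertical part of the extended coaction and bilinearity of π_ver. -/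

namespace CoactionExtension

variable {Δ : RightComoduleAlgebra k H A} {D : DifferentialCalculus k A 𝒜}
  (L : LeftCovariant C) (X : CoactionExtension Δ D C.maximalProlongation)

open DifferentialCalculus

/-- The component in `A ⊗ Γ` of the extended coaction. -/
noncomputable def vertPart : Ω →ₗ[k] A ⊗[k] Γ := projZeroOne C D ∘ₗ X.hom.toLinearMap

theorem vertPart_apply (ω : Ω) : X.vertPart ω = projZeroOne C D (X.hom ω) := rfl

theorem hom_ι_eq (a : A) : X.hom (D.ι a) = inclZeroZero C D (Δ.coact a) := X.hom_ι a

theorem vertPart_ι_mul (a : A) (ω : Ω) : X.vertPart (D.ι a * ω) =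
    TensorProduct.map₂ (LinearMap.mul k A) (leftMul k H Γ) (Δ.coact a) (X.vertPart ω) := by
  rw [vertPart_apply, map_mul, hom_ι_eq, projZeroOne_inclZeroZero_mul, vertPart_apply]

theorem vertPart_mul_ι (ω : Ω) (a : A) : X.vertPart (ω * D.ι a) =
    TensorProduct.map₂ (LinearMap.mul k A) (rightMul k H Γ).flip (X.vertPart ω) (Δ.coact a) := by
  rw [vertPart_apply, map_mul, hom_ι_eq, projZeroOne_mul_inclZeroZero, vertPart_apply]

/-- Compatibility of the extended coaction with the differentials gives Δ^∧(da) = da₀ ⊗ a₁ + a₀ ⊗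
da₁, whose second term is the part in A ⊗ Γ. -/
theorem vertPart_d_ι (a : A) :
    X.vertPart (D.d (D.ι a)) = LinearMap.lTensor A C.d (Δ.coact a) := by
  rw [vertPart_apply, X.hom_d, hom_ι_eq, projZeroOne_dTensor_inclZeroZero]

theorem piVer_eq (ω : Ω) : piVer L X ω = LinearMap.lTensor A L.piInv (X.vertPart ω) := by
  have : TensorProduct.map D.projZero (L.piInv ∘ₗ MaxProl.projOne C) =
      LinearMap.lTensor A L.piInv ∘ₗ TensorProduct.map D.projZero (MaxProl.projOne C) := by
    rw [LinearMap.lTensor, ← TensorProduct.map_comp, LinearMap.id_comp]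
  rw [piVer, this]
  rfl

/-- The factor a acts on A ⊗ Γ through a₀ ⊗ a₁; after π_inv the leg a₁ contributes ε(a₁), and
a₀ε(a₁) = a. -/
theorem piVer_ι_mul (a : A) (ω : Ω) : piVer L X (D.ι a * ω) = a • piVer L X ω := by
  rw [piVer_eq, piVer_eq, vertPart_ι_mul]
  -- Writing a as a₀ε(a₁) makes both sides linear in Δ_A(a), which can then be replaced by an
  -- arbitrary tensor.
  have h : a = TensorProduct.rid k A (LinearMap.lTensor A Coalgebra.counit (Δ.coact a)) :=
    (LinearMap.congr_fun Δ.counit a).symm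
  conv_rhs => rw [h]
  generalize Δ.coact a = s
  generalize X.vertPart ω = t
  induction s with
  | zero => simp
  | add x y hx hy => simp only [map_add, LinearMap.add_apply, hx, hy, add_smul]
  | tmul b h =>
    induction t with
    | zero => simp
    | add x y hx hy => simp only [map_add, hx, hy, smul_add]
    | tmul c γ =>
      simp [L.piInv_smul, TensorProduct.smul_tmul']

/-- By π_inv(γh) = π_inv(γ) ↼ h, right multiplication by a₀ ⊗ a₁ on A ⊗ Γ descends to the action
defining `verRightMul`. -/
theorem piVer_mul_ι (ω : Ω) (a : A) :
    piVer L X (ω * D.ι a) = verRightMul Δ L (piVer L X ω) a := by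
  rw [verRightMul, piVer_eq, piVer_eq, vertPart_mul_ι]
  generalize Δ.coact a = s
  generalize X.vertPart ω = t
  induction s with
  | zero => simp
  | add x y hx hy => simp only [map_add, hx, hy]
  | tmul b h =>
    induction t with
    | zero => simp
    | add x y hx hy => simp only [map_add, hx, hy, LinearMap.add_apply]
    | tmul c γ => simp [L.piInv_op_smul]

/-! ### Recovering the vertical part from π_ver: the kernel is horizontal. -/

variable (Δ) in
/-- The map `a ⊗ θ ↦ a₀ ⊗ a₁ θ`, which recovers the component in `A ⊗ Γ` from the vertical
part. -/
noncomputable def coactForm : VerOne A L →ₗ[k] A ⊗[k] Γ :=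
  TensorProduct.lift (LinearMap.mk₂ k
    (fun a θ => LinearMap.lTensor A ((leftMul k H Γ).flip (θ : Γ)) (Δ.coact a))
    (fun a b θ => by simp only [map_add]) (fun r a θ => by simp only [map_smul])
    (fun a θ η => by
      simp only [Submodule.coe_add, map_add, LinearMap.lTensor_add, LinearMap.add_apply])
    (fun r a θ => by
      simp only [Submodule.coe_smul, map_smul, LinearMap.lTensor_smul, LinearMap.smul_apply]))

theorem coactForm_tmul (a : A) (θ : L.coinvariantForms) : coactForm Δ L (a ⊗ₜ θ) =
    LinearMap.lTensor A ((leftMul k H Γ).flip (θ : Γ)) (Δ.coact a) := rfl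

/-- Multiplicativity of Δ_A gives (ab)₀ ⊗ (ab)₁θ = a₀b₀ ⊗ a₁b₁θ. This is the transformation rule of
`vertPart_ι_mul`, so the two can be compared on generators. -/
theorem coactForm_smul (a : A) (v : VerOne A L) : coactForm Δ L (a • v) =
    TensorProduct.map₂ (LinearMap.mul k A) (leftMul k H Γ) (Δ.coact a) (coactForm Δ L v) := by
  induction v using TensorProduct.induction_on with
  | zero => simp
  | add x y hx hy => rw [smul_add, map_add, hx, hy, map_add, map_add]
  | tmul b θ =>
    rw [TensorProduct.smul_tmul', smul_eq_mul, coactForm_tmul, coactForm_tmul, map_mul]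
    generalize Δ.coact a = s
    generalize Δ.coact b = t
    induction s with
    | zero => simp
    | add x y hx hy => simp only [map_add, add_mul, LinearMap.add_apply, hx, hy]
    | tmul b h =>
      induction t with
      | zero => simp
      | add x y hx hy => simp only [map_add, mul_add, hx, hy]
      | tmul c γ => simp [mul_smul]

/-- By coassociativity the left side is a₀ ⊗ a₁ π_inv(da₂). Left covariance of d makes a₁ ⊗ da₂ the
coaction of da₁, and γ₋₁ π_inv(γ₀) = γ finishes. -/
theorem coactForm_lTensor_d (a : A) :
    coactForm Δ L (LinearMap.lTensor A (L.piInv ∘ₗ C.d) (Δ.coact a)) =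
      LinearMap.lTensor A C.d (Δ.coact a) := by
  have h1 : ∀ s : A ⊗[k] H, coactForm Δ L (LinearMap.lTensor A (L.piInv ∘ₗ C.d) s) =
      LinearMap.lTensor A (TensorProduct.lift (leftMul k H Γ) ∘ₗ
        LinearMap.lTensor H (L.invMap ∘ₗ C.d))
        (TensorProduct.assoc k A H H (LinearMap.rTensor H Δ.coact.toLinearMap s)) := by
    intro s
    induction s with
    | zero => simp
    | add x y hx hy => simp only [map_add, hx, hy]
    | tmul b h =>
      rw [LinearMap.lTensor_tmul, coactForm_tmul, LinearMap.rTensor_tmul, AlgHom.toLinearMap_apply]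
      generalize Δ.coact b = t
      induction t with
      | zero => simp
      | add x y hx hy => simp only [map_add, TensorProduct.add_tmul, hx, hy]
      | tmul c g => rfl
  have h2 := LinearMap.congr_fun Δ.coassoc a
  simp only [LinearMap.comp_apply, LinearEquiv.coe_coe, AlgHom.toLinearMap_apply] at h2
  rw [h1, h2, ← LinearMap.comp_apply, ← LinearMap.lTensor_comp]
  congr 2
  ext h
  -- The identity γ₋₁ π_inv(γ₀) = γ at γ = dh, with the coaction of dh replaced by h₁ ⊗ dh₂.
  have h3 := LinearMap.congr_fun L.act_invMap (C.d h)
  rw [LeftCovariant.act, LinearMap.comp_apply, LinearMap.comp_apply, L.coact_d,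
    ← LinearMap.comp_apply (LinearMap.lTensor H _), ← LinearMap.lTensor_comp] at h3
  exact h3

theorem coactForm_piVer {ω : Ω} (hω : ω ∈ 𝒜 1) : coactForm Δ L (piVer L X ω) = X.vertPart ω := by
  refine D.induction_one (P := fun ω => coactForm Δ L (piVer L X ω) = X.vertPart ω) hω
    (fun a b => ?_) (fun x y hx hy => by rw [map_add, map_add, hx, hy, map_add])
  rw [piVer_ι_mul, coactForm_smul, vertPart_ι_mul, piVer_eq, vertPart_d_ι,
    ← LinearMap.comp_apply (LinearMap.lTensor A L.piInv), ← LinearMap.lTensor_comp,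
    coactForm_lTensor_d]

/-- The horizontal one-forms are the kernel of `piVer` on one-forms. -/
theorem mem_horOne_iff {ω : Ω} (hω : ω ∈ 𝒜 1) : ω ∈ X.horOne ↔ piVer L X ω = 0 := by
  constructor
  · rintro ⟨h, -⟩
    have h' : X.vertPart ω = 0 := projZeroOne_of_horizontal C D h
    rw [piVer_eq, h', map_zero]
  · intro h
    refine ⟨horizontal_of_projZeroOne C D (X.hom_mem 1 ω hω) ?_, hω⟩
    change X.vertPart ω = 0
    -- The part in A ⊗ Γ is a linear function of π_ver(ω), so it vanishes with it.
    rw [← X.coactForm_piVer L hω, h, map_zero]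

/-- This exhibits the canonical map inside π_ver, so that the Hopf–Galois condition can be used for
surjectivity. -/
theorem piVer_ι_mul_d_ι (a b : A) : piVer L X (D.ι a * D.d (D.ι b)) =
    LinearMap.lTensor A (L.piInv ∘ₗ C.d) (Δ.canonicalLift (a ⊗ₜ b)) := by
  rw [piVer_ι_mul, piVer_eq, vertPart_d_ι, RightComoduleAlgebra.canonicalLift_tmul,
    ← LinearMap.comp_apply, ← LinearMap.lTensor_comp]
  generalize Δ.coact b = s
  induction s with
  | zero => simp
  | add x y hx hy => simp only [map_add, mul_add, smul_add, hx, hy]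
  | tmul c h => simp [TensorProduct.smul_tmul']

theorem piVer_surjective (hΔ : Function.Surjective Δ.canonicalMap) :
    Function.Surjective (piVer L X ∘ₗ (𝒜 1).subtype) := by
  intro v
  obtain ⟨s, rfl⟩ := LinearMap.lTensor_surjective A L.piInv_d_surjective v
  obtain ⟨q, rfl⟩ := hΔ s
  obtain ⟨t, rfl⟩ := QuotientAddGroup.mk_surjective q
  -- Preimages are sought on a representative t in the tensor product over the integers; since the
  -- range is a submodule, pure tensors suffice, and a ⊗ b is hit by a db.
  change LinearMap.lTensor A (L.piInv ∘ₗ C.d) (Δ.canonicalLift t) ∈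
    LinearMap.range (piVer L X ∘ₗ (𝒜 1).subtype)
  induction t with
  | zero => simp
  | add x y hx hy => simp only [map_add]; exact add_mem hx hy
  | tmul a b =>
    refine ⟨⟨D.ι a * D.d (D.ι b), D.ι_mul_mem a (D.d_mem 0 _ (D.ι_mem b))⟩, ?_⟩
    exact X.piVer_ι_mul_d_ι L a b

end CoactionExtension

end Complete

end QuantumBundle

/-! ### The short exact sequence. -/

theorem mainTheorem4
    (k : Type*) [Field k] (H : Type*) [Ring H] [HopfAlgebra k H]
    (A : Type*) [Ring A] [Algebra k A]
    (Δ : QuantumBundle.RightComoduleAlgebra k H A) (hΔ : Δ.IsQuantumPrincipalBundle)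
    (Γ : Type*) [AddCommGroup Γ] [Module k Γ] [Module H Γ] [Module Hᵐᵒᵖ Γ]
    [IsScalarTower k H Γ] [IsScalarTower k Hᵐᵒᵖ Γ] [SMulCommClass H Hᵐᵒᵖ Γ]
    (C : QuantumBundle.FirstOrderCalculus k H Γ)
    (L : QuantumBundle.LeftCovariant C) (R : QuantumBundle.RightCovariant C)
    (Ω : Type*) [Ring Ω] [Algebra k Ω] (𝒜 : ℕ → Submodule k Ω) [GradedAlgebra 𝒜]
    (D : QuantumBundle.DifferentialCalculus k A 𝒜)
    (X : QuantumBundle.CoactionExtension Δ D C.maximalProlongation) :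
    (∀ a : A, ∀ ω ∈ X.horOne, D.ι a * ω ∈ X.horOne ∧ ω * D.ι a ∈ X.horOne) ∧
    (∀ a : A, ∀ ω ∈ 𝒜 1,
      QuantumBundle.piVer L X (D.ι a * ω) = a • QuantumBundle.piVer L X ω ∧
      QuantumBundle.piVer L X (ω * D.ι a) =
        QuantumBundle.verRightMul Δ L (QuantumBundle.piVer L X ω) a) ∧
    Function.Injective (Submodule.inclusion X.horOne_le) ∧
    Function.Exact (Submodule.inclusion X.horOne_le)
      (QuantumBundle.piVer L X ∘ₗ (𝒜 1).subtype) ∧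
    Function.Surjective (QuantumBundle.piVer L X ∘ₗ (𝒜 1).subtype) := by
  refine ⟨fun a ω hω => ?_, fun a ω _ => ⟨X.piVer_ι_mul L a ω, X.piVer_mul_ι L ω a⟩,
    Submodule.inclusion_injective _, fun ω => ?_, X.piVer_surjective L hΔ.hopfGalois.2⟩
  -- Horizontality is turned into vanishing of π_ver, and both module structures on vertical forms
  -- send zero to zero.
  · have h1 := X.horOne_le hω
    have h0 := (X.mem_horOne_iff L h1).mp hω
    rw [X.mem_horOne_iff L (D.ι_mul_mem a h1), X.mem_horOne_iff L (D.mul_ι_mem a h1),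
      X.piVer_ι_mul, X.piVer_mul_ι, h0]
    exact ⟨smul_zero a, QuantumBundle.verRightMul_zero Δ L a⟩
  · rw [LinearMap.comp_apply, Submodule.subtype_apply, ← X.mem_horOne_iff L ω.2]
    exact ⟨fun h => ⟨⟨ω, h⟩, rfl⟩, by rintro ⟨η, rfl⟩; exact η.2⟩
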